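/- Let $\mathcal M$ be a model category (with all small limits and colimits), let $K$ and $L$ be simplicial sets and let $f:L\to K$ be a map. Write $\mathbf K$ for the simplex category of $K$: its objects are the simplices $\sigma:\Delta[n]\to K$, its morphisms are the maps $\Delta[n]\to\Delta[m]$ over $K$. A functor $F:\mathbf K\to\mathcal M$ is called bounded if it sends every degeneracy morphism $s_i:s_i\sigma\to\sigma$ to an isomorphism; $Fun^b(\mathbf K,\mathcal M)$ is the full subcategory of $Fun(\mathbf K,\mathcal M)$ of bounded functors. For a natural transformation $\Psi:F\to G$ and a simplex $\sigma:\Delta[n]\to K$, let $$M_\Psi(\sigma)=\mathrm{colim}\Big(\mathrm{colim}_{\mathbf{\Delta}[n]}F\leftarrow \mathrm{colim}_{\boldsymbol{\partial\Delta}[n]}F\to \mathrm{colim}_{\boldsymbol{\partial\Delta}[n]}G\Big),$$ where $F$ and $G$ are pulled back along $\partial\Delta[n]\hookrightarrow\Delta[n]\xrightarrow{\sigma}K$; there is a natural map $M_\Psi(\sigma)\to \mathrm{colim}_{\mathbf{\Delta}[n]}G\cong G(\sigma)$. "Acyclic" means "and a weak equivalence". A functor is called homotopy meaningful on cofibrant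 objects if it sends weak equivalences between cofibrant objects to weak equivalences. 1. $Fun^b(\mathbf K,\mathcal M)$ has all small limits and colimits and is a model category in which $\Psi:F\to G$ is a weak equivalence (respectively a fibration) if and only if $\Psi_\sigma:F(\sigma)\to G(\sigma)$ is one in $\mathcal M$ for every simplex $\sigma$ of $K$, and is a cofibration if and only if $M_\Psi(\sigma)\to G(\sigma)$ is a cofibration in $\mathcal M$ for every non-degenerate simplex $\sigma$ of $K$. 2. The functor $\mathrm{colim}_{\mathbf K}:Fun^b(\mathbf K,\mathcal M)\to\mathcal M$ is homotopy meaningful on cofibrant objects, and it sends cofibrations to cofibrations, acyclic cofibrations to acyclic cofibrations, and cofibrant objects to cofibrant objects. 3. Let $f^*:Fun^b(\mathbf K,\mathcal M)\to Fun^b(\mathbf L,\mathcal M)$ be the pull-back along $f$. The functor $F\mapsto\mathrm{colim}_{\mathbf L}f^*F$, $Fun^b(\mathbf K,\mathcal M)\to\mathcal M$, sends cofibrations to cofibrations, acyclic cofibrations to acyclic cofibrations, and cofibrant objects to cofibrant objects. 4. The left Kan extension along $f$ of a bounded diagram is bounded, and the resulting functor $f^k:Fun^b(\mathbf L,\mathcal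 M)\to Fun^b(\mathbf K,\mathcal M)$ is homotopy meaningful on cofibrant objects and sends cofibrations to cofibrations, acyclic cofibrations to acyclic cofibrations, and cofibrant objects to cofibrant objects. Moreover $f^k$ is left adjoint to $f^*$, and $f^*$ preserves fibrations and acyclic fibrations, so that $(f^k,f^*)$ is a Quillen pair. -/

import Mathlib

open CategoryTheory Limits HomotopicalAlgebra Simplicial Opposite

universe w v u

noncomputable section

namespace BoundedDiagrams

/-- The simplex category of a simplicial set `K`: its objects are the simplices of `K`, i.e. the
maps `σ : Δ[n] ⟶ K`, and a morphism `σ ⟶ τ` from an `n`-simplex to an `m`-simplex is a map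
`φ : ⦋n⦌ ⟶ ⦋m⦌` with `φ^* τ = σ`, i.e. a commutative triangle over `K`. -/
abbrev SimplexCat (K : SSet.{w}) := K.Elementsᵒᵖ

/-- The simplex `x`, seen as an object of the simplex category of `K`. -/
abbrev SimplexCat.mk {K : SSet.{w}} {n : SimplexCategory} (x : K.obj (op n)) : SimplexCat K :=
  op (Functor.elementsMk K (op n) x)

/-- The morphism `φ^* x = y ⟶ x` of the simplex category given by `φ`. -/
abbrev SimplexCat.homMk {K : SSet.{w}} {n m : SimplexCategory} (φ : m ⟶ n) (x : K.obj (op n))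
    (y : K.obj (op m)) (h : K.map φ.op x = y) : SimplexCat.mk y ⟶ SimplexCat.mk x :=
  (CategoryOfElements.homMk (Functor.elementsMk K (op n) x) (Functor.elementsMk K (op m) y)
    φ.op h).op

/-- The functor between simplex categories induced by a map of simplicial sets. -/
abbrev SimplexCat.map {L K : SSet.{w}} (f : L ⟶ K) : SimplexCat L ⥤ SimplexCat K :=
  (CategoryOfElements.map f).op

section Bounded

variable (K : SSet.{w}) (C : Type u) [Category.{v} C]

/-- A diagram `F` indexed by the simplex category of `K` is bounded if it sends every degeneracy
morphism `sᵢ : y = sᵢ x ⟶ x` to an isomorphism. -/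
def IsBounded : ObjectProperty (SimplexCat K ⥤ C) := fun F =>
  ∀ ⦃n : ℕ⦄ (i : Fin (n + 1)) (x : K _⦋n⦌) (y : K _⦋n + 1⦌)
    (h : K.map (SimplexCategory.σ i).op x = y),
    IsIso (F.map (SimplexCat.homMk (SimplexCategory.σ i) x y h))

/-- The category of bounded diagrams, a full subcategory of the category of all diagrams. -/
abbrev FunB := (IsBounded K C).FullSubcategory

variable {K} {L : SSet.{w}} (f : L ⟶ K)

/-- The pull-back process along `f : L ⟶ K` on bounded diagrams. -/
def pullB : FunB K C ⥤ FunB L C :=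
  (IsBounded L C).lift
    ((IsBounded K C).ι ⋙ (Functor.whiskeringLeft _ _ C).obj (SimplexCat.map f))
    (fun F _ i x y h => F.property i (f.app _ x) (f.app _ y)
      (by rw [← h]; exact (NatTrans.naturality_apply f _ x).symm))

end Bounded

section Colimits

variable (K : SSet.{w}) {L : SSet.{w}} (M : Type u) [Category.{v} M]

theorem hasColimitsOfShape_of_small [HasColimitsOfSize.{w, w} M]
    (J : Type w) [Category.{0} J] : HasColimitsOfShape J M :=
  have : LocallySmall.{w} J := ⟨fun _ _ => inferInstance⟩
  hasColimitsOfShape_of_equivalence (equivSmallModel.{w} J).symm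

instance [HasColimitsOfSize.{w, w} M] : HasColimitsOfShape (SimplexCat K) M :=
  hasColimitsOfShape_of_small M _

instance [HasColimitsOfSize.{w, w} M] {K : SSet.{w}} (f : L ⟶ K) (σ : SimplexCat K) :
    HasColimitsOfShape (CostructuredArrow (SimplexCat.map f) σ) M :=
  hasColimitsOfShape_of_small M _

/-- The colimit functor on bounded diagrams. -/
def colimB [HasColimitsOfSize.{w, w} M] : FunB K M ⥤ M := (IsBounded K M).ι ⋙ colim

/-- The left Kan extension functor along `f : L ⟶ K` on all diagrams. -/
abbrev lan [HasColimitsOfSize.{w, w} M] {K : SSet.{w}} (f : L ⟶ K) :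
    (SimplexCat L ⥤ M) ⥤ (SimplexCat K ⥤ M) :=
  (SimplexCat.map f).lan

/-- The left Kan extension functor along `f : L ⟶ K` on bounded diagrams, given that the left
Kan extension of a bounded diagram is bounded. -/
def lanB [HasColimitsOfSize.{w, w} M] {K : SSet.{w}} (f : L ⟶ K)
    (hf : ∀ F : FunB L M, IsBounded K M ((lan M f).obj F.obj)) : FunB L M ⥤ FunB K M :=
  (IsBounded K M).lift ((IsBounded L M).ι ⋙ lan M f) hf

/-- The constant diagram at the initial object. -/
def emptyDiagram [HasInitial M] : FunB K M where
  obj := (Functor.const _).obj (⊥_ M)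
  property := fun _ _ _ _ _ => by dsimp; infer_instance

/-- The constant diagram at the initial object is an initial bounded diagram. -/
def isInitialEmptyDiagram [HasInitial M] : IsInitial (emptyDiagram K M) :=
  IsInitial.ofUniqueHom
    (fun F => ObjectProperty.homMk
      { app := fun σ => initial.to (F.obj.obj σ)
        naturality := fun _ _ _ => initialIsInitial.hom_ext _ _ })
    (fun F m => by
      apply ObjectProperty.hom_ext
      ext σ
      exact initialIsInitial.hom_ext _ _)

instance [HasInitial M] : HasInitial (FunB K M) := (isInitialEmptyDiagram K M).hasInitial

end Colimits

section Latching

variable {K : SSet.{w}} {M : Type u} [Category.{v} M] [HasColimitsOfSize.{w, w} M]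

/-- `∂Δ[n] ⟶ Δ[n]`, on simplex categories. -/
abbrev boundaryFunctor (n : ℕ) :
    SimplexCat (SSet.boundary.{w} n : SSet.{w}) ⥤ SimplexCat (Δ[n] : SSet.{w}) :=
  SimplexCat.map (SSet.boundary n).ι

/-- `σ : Δ[n] ⟶ K`, on simplex categories, where `σ` is the map classifying the simplex `x`. -/
abbrev simplexFunctor {n : ℕ} (x : K _⦋n⦌) : SimplexCat (Δ[n] : SSet.{w}) ⥤ SimplexCat K :=
  SimplexCat.map (SSet.yonedaEquiv.symm x)

/-- `colim_{Δ[n]} F`, where `F` is pulled back along the map `Δ[n] ⟶ K` classifying `x`. -/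
abbrev simplexColim (F : SimplexCat K ⥤ M) {n : ℕ} (x : K _⦋n⦌) : M :=
  colimit (simplexFunctor x ⋙ F)

/-- `colim_{∂Δ[n]} F`, where `F` is pulled back along `∂Δ[n] ⟶ Δ[n] ⟶ K`. -/
abbrev boundaryColim (F : SimplexCat K ⥤ M) {n : ℕ} (x : K _⦋n⦌) : M :=
  colimit (boundaryFunctor n ⋙ simplexFunctor x ⋙ F)

/-- The canonical map `colim_{∂Δ[n]} F ⟶ colim_{Δ[n]} F`. -/
def boundaryToSimplex (F : SimplexCat K ⥤ M) {n : ℕ} (x : K _⦋n⦌) :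
    boundaryColim F x ⟶ simplexColim F x :=
  colimit.pre (simplexFunctor x ⋙ F) (boundaryFunctor n)

/-- The cocone with point `F(x)` on the restriction of `F` to `Δ[n]`: its component at a simplex
`t : Δ[m] ⟶ Δ[n]` is the value of `F` at the morphism `t^* x ⟶ x` given by `t`. -/
def simplexCocone (F : SimplexCat K ⥤ M) {n : ℕ} (x : K _⦋n⦌) : Cocone (simplexFunctor x ⋙ F) where
  pt := F.obj (SimplexCat.mk x)
  ι :=
    { app := fun t => F.map (SimplexCat.homMk (SSet.stdSimplex.objEquiv t.unop.2) x
        ((SSet.yonedaEquiv.symm x).app _ t.unop.2) rfl)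
      naturality := fun t t' φ => by
        refine (F.map_comp _ _).symm.trans (Eq.trans ?_ (Category.comp_id _).symm)
        refine congrArg F.map (Quiver.Hom.unop_inj (Subtype.ext ?_))
        have h : SSet.stdSimplex.objEquiv t.unop.2 =
            φ.unop.1.unop ≫ SSet.stdSimplex.objEquiv t'.unop.2 :=
          congrArg SSet.stdSimplex.objEquiv φ.unop.2.symm
        exact congrArg Quiver.Hom.op h.symm }

/-- The canonical map `colim_{Δ[n]} F ⟶ F(x)`. It is an isomorphism, since the simplex
category of `Δ[n]` has a terminal object, which is sent to `x`. -/
def simplexToValue (F : SimplexCat K ⥤ M) {n : ℕ} (x : K _⦋n⦌) :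
    simplexColim F x ⟶ F.obj (SimplexCat.mk x) :=
  colimit.desc _ (simplexCocone F x)

variable {F G : SimplexCat K ⥤ M} (Ψ : F ⟶ G) {n : ℕ} (x : K _⦋n⦌)

/-- The map `colim_{Δ[n]} Ψ`. -/
def simplexColimMap : simplexColim F x ⟶ simplexColim G x :=
  colimMap (Functor.whiskerLeft (simplexFunctor x) Ψ)

/-- The map `colim_{∂Δ[n]} Ψ`. -/
def boundaryColimMap : boundaryColim F x ⟶ boundaryColim G x :=
  colimMap (Functor.whiskerLeft (boundaryFunctor n) (Functor.whiskerLeft (simplexFunctor x) Ψ))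

theorem boundaryToSimplex_naturality :
    boundaryToSimplex F x ≫ simplexColimMap Ψ x =
      boundaryColimMap Ψ x ≫ boundaryToSimplex G x := by
  ext t
  simp [boundaryToSimplex, simplexColimMap, boundaryColimMap]

variable [HasPushouts M]

/-- The object `M_Ψ(x)`: the push-out of
`colim_{Δ[n]} F ⟵ colim_{∂Δ[n]} F ⟶ colim_{∂Δ[n]} G`. -/
def latchingObj : M := pushout (boundaryToSimplex F x) (boundaryColimMap Ψ x)

/-- The map `M_Ψ(x) ⟶ colim_{Δ[n]} G ≅ G(x)`. -/
def latchingMap : latchingObj Ψ x ⟶ G.obj (SimplexCat.mk x) :=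
  pushout.desc (simplexColimMap Ψ x) (boundaryToSimplex G x)
    (boundaryToSimplex_naturality Ψ x) ≫ simplexToValue G x

end Latching

section ModelStructure

variable (K : SSet.{w}) (M : Type u) [Category.{v} M]

/-- Weak equivalences of bounded diagrams are the objectwise weak equivalences. -/
instance boundedWeakEquivalences [CategoryWithWeakEquivalences M] :
    CategoryWithWeakEquivalences (FunB K M) where
  weakEquivalences := fun _ _ Ψ => ∀ σ : SimplexCat K, WeakEquivalence (Ψ.hom.app σ)

/-- Fibrations of bounded diagrams are the objectwise fibrations. -/
instance boundedFibrations [CategoryWithFibrations M] : CategoryWithFibrations (FunB K M) where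
  fibrations := fun _ _ Ψ => ∀ σ : SimplexCat K, Fibration (Ψ.hom.app σ)

/-- A map `Ψ : F ⟶ G` of bounded diagrams is a cofibration if, for every non-degenerate simplex
`x` of `K`, the map `M_Ψ(x) ⟶ G(x)` is a cofibration. -/
instance boundedCofibrations [CategoryWithCofibrations M] [HasPushouts M]
    [HasColimitsOfSize.{w, w} M] : CategoryWithCofibrations (FunB K M) where
  cofibrations := fun _ _ Ψ =>
    ∀ (n : ℕ) (x : K _⦋n⦌), x ∈ K.nonDegenerate n → Cofibration (latchingMap Ψ.hom x)

end ModelStructure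

section QuillenPairs

variable {C : Type*} [Category* C] {D : Type*} [Category* D]

/-- A functor is homotopy meaningful on cofibrant objects if it sends weak equivalences between
cofibrant objects to weak equivalences. -/
def HomotopyMeaningfulOnCofibrant [CategoryWithCofibrations C] [CategoryWithWeakEquivalences C]
    [HasInitial C] [CategoryWithWeakEquivalences D] (H : C ⥤ D) : Prop :=
  ∀ ⦃X Y : C⦄ (f : X ⟶ Y), IsCofibrant X → IsCofibrant Y → WeakEquivalence f →
    WeakEquivalence (H.map f)

/-- A functor preserves cofibrations and acyclic cofibrations. -/
structure PreservesCofibrations [CategoryWithCofibrations C] [CategoryWithWeakEquivalences C]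
    [CategoryWithCofibrations D] [CategoryWithWeakEquivalences D] (H : C ⥤ D) : Prop where
  cofibration : ∀ ⦃X Y : C⦄ (f : X ⟶ Y), cofibrations C f → cofibrations D (H.map f)
  acyclic : ∀ ⦃X Y : C⦄ (f : X ⟶ Y), trivialCofibrations C f → trivialCofibrations D (H.map f)

/-- A functor preserves fibrations and acyclic fibrations. -/
structure PreservesFibrations [CategoryWithFibrations C] [CategoryWithWeakEquivalences C]
    [CategoryWithFibrations D] [CategoryWithWeakEquivalences D] (H : C ⥤ D) : Prop where
  fibration : ∀ ⦃X Y : C⦄ (f : X ⟶ Y), fibrations C f → fibrations D (H.map f)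
  acyclic : ∀ ⦃X Y : C⦄ (f : X ⟶ Y), trivialFibrations C f → trivialFibrations D (H.map f)

/-- `(l, r)` is a Quillen pair: `l` is left adjoint to `r`, it preserves (acyclic) cofibrations
and is homotopy meaningful on cofibrant objects, and `r` preserves (acyclic) fibrations. -/
structure IsQuillenPair [CategoryWithCofibrations C] [CategoryWithFibrations C]
    [CategoryWithWeakEquivalences C] [HasInitial C] [CategoryWithCofibrations D]
    [CategoryWithFibrations D] [CategoryWithWeakEquivalences D] (l : C ⥤ D) (r : D ⥤ C) :
    Prop where
  adjunction : Nonempty (l ⊣ r)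
  left : PreservesCofibrations l
  meaningful : HomotopyMeaningfulOnCofibrant l
  right : PreservesFibrations r

end QuillenPairs

end BoundedDiagrams

end

open BoundedDiagrams

noncomputable section

namespace BoundedDiagrams

/-! Call two morphisms of simplices equivalent if they agree after composition with a degeneracy. A
bounded diagram inverts degeneracies, so it identifies equivalent morphisms; conversely degeneracies
become invertible in the quotient by the generated congruence. Hence bounded diagrams are all
diagrams on this quotient (`reducedEquivalence`). There every simplex is isomorphic to a
nondegenerate one, and morphisms out of nondegenerate simplices come from injections, so the
quotient is essentially a direct category graded by dimension (`dimFiltration`).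

Over a direct category a map `F ⟶ G` is factored degree by degree: at each cell of degree `n` the
map from the current stage to `G` is factored in `M`, and the middle object is attached freely. A
diagram that is free on cells of dimension `< n` is, at a nondegenerate `n`-simplex, the colimit
over the boundary (`isColimitBoundaryCocone`). So at such a simplex the stage with cells of
dimension `< n` is the pushout of the value of `F` with the boundary colimit, and latching maps
measure the next attachment. Therefore lifting against objectwise (acyclic) fibrations is detected
by latching maps (`llp_of_latchingMap`, `latchingMap_of_llp`), and the two weak factorization
systems follow.

A colimit along a functor is left adjoint to the Kan extension of constant diagrams, which preserves
right lifting classes (`ranConst_map_mem`). This handles the colimit functors. Applied to `Δ[n]`,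
whose simplex category has a terminal object, it also shows that maps lifting against objectwise
fibrations are objectwise acyclic. Left Kan extensions of bounded diagrams are bounded by a prism
argument (`IsBounded.extensionMap_eq`). The remaining claims follow by adjunction and Ken Brown's
lemma. -/

/-- A filtration of the objects of a category by degrees, exhibiting it (up to equivalence) as a
direct category: the full subcategory on the chosen objects of a given degree is discrete, and
morphisms do not decrease the degree. -/
structure DirectFiltration (D : Type w) [Category.{0} D] where
  /-- The set of chosen objects of degree `n`. -/
  cells : ℕ → Type w
  /-- The chosen objects of degree `n`. -/
  obj : ∀ n, cells n → D
  full : ∀ n, (Discrete.functor (obj n)).Full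
  le_of_hom : ∀ {m n : ℕ} {a : cells m} {b : cells n}, (obj m a ⟶ obj n b) → m ≤ n
  exists_iso : ∀ X : D, ∃ (n : ℕ) (a : cells n), Nonempty (X ≅ obj n a)

namespace DirectFiltration

variable {D : Type w} [Category.{0} D] (S : DirectFiltration D)
  {M : Type u} [Category.{v} M] [HasColimitsOfSize.{w, w} M]

/-- The inclusion of the chosen objects of degree `n`. -/
abbrev incl (n : ℕ) : Discrete (S.cells n) ⥤ D := Discrete.functor (S.obj n)

instance (n : ℕ) : (S.incl n).Full := S.full n

instance (n : ℕ) : (S.incl n).Faithful where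
  map_injective _ := Subsingleton.elim _ _

instance (n : ℕ) (X : D) : HasColimitsOfShape (CostructuredArrow (S.incl n) X) M :=
  inferInstance

/-! ### Attaching cells of one degree to a diagram. -/

section attach

variable (n : ℕ) {Z : D ⥤ M} (A : S.cells n → M) (i : ∀ a, Z.obj (S.obj n a) ⟶ A a)

/-- The free diagram on a family of objects in degree `n`. -/
abbrev free (A : Discrete (S.cells n) ⥤ M) : D ⥤ M := (S.incl n).lan.obj A

/-- The diagram obtained from `Z` by replacing, in degree `n`, its values by the objects `A a`. -/
def attach : D ⥤ M :=
  pushout (((S.incl n).lanAdjunction M).counit.app Z)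
    ((S.incl n).lan.map (Discrete.natTrans (G := Discrete.functor A) fun a => i a.as))

/-- The canonical map from `Z`. -/
def attachι : Z ⟶ S.attach n A i := pushout.inl _ _

/-- The canonical map from the attached cells. -/
def attachCell : S.free n (Discrete.functor A) ⟶ S.attach n A i := pushout.inr _ _

lemma attach_isPushout :
    IsPushout (((S.incl n).lanAdjunction M).counit.app Z)
      ((S.incl n).lan.map (Discrete.natTrans (G := Discrete.functor A) fun a => i a.as))
      (S.attachι n A i) (S.attachCell n A i) :=
  IsPushout.of_hasPushout _ _

/-- The canonical map from the object attached at `a`. -/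
def attachApp (a : S.cells n) : A a ⟶ (S.attach n A i).obj (S.obj n a) :=
  ((S.incl n).lanUnit.app (Discrete.functor A)).app ⟨a⟩ ≫ (S.attachCell n A i).app (S.obj n a)

/-- The inclusion of the cells is fully faithful, so the unit of the Kan extension is invertible;
the triangle identity transfers this to the counit at a cell. -/
instance (a : S.cells n) : IsIso (((((S.incl n).lanAdjunction M).counit.app Z)).app (S.obj n a)) := by
  have h := (S.incl n).lanUnit_app_app_lanAdjunction_counit_app_app Z ⟨a⟩
  exact IsIso.of_isIso_fac_left h

instance (a : S.cells n) : IsIso (S.attachApp n A i a) := by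
  have h := (S.attach_isPushout n A i).map ((evaluation D M).obj (S.obj n a))
  have : IsIso (((evaluation D M).obj (S.obj n a)).map
      (((S.incl n).lanAdjunction M).counit.app Z)) :=
    inferInstanceAs (IsIso (((((S.incl n).lanAdjunction M).counit.app Z)).app (S.obj n a)))
  have : IsIso ((S.attachCell n A i).app (S.obj n a)) := h.isIso_inr_of_isIso
  have : IsIso (((S.incl n).lanUnit.app (Discrete.functor A)).app ⟨a⟩) := inferInstance
  exact IsIso.comp_isIso

lemma attachApp_fac (a : S.cells n) :
    i a ≫ S.attachApp n A i a = (S.attachι n A i).app (S.obj n a) := by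
  have h1 := congr_app ((S.incl n).lanUnit.naturality
    (Discrete.natTrans (F := S.incl n ⋙ Z) (G := Discrete.functor A) fun a => i a.as)) ⟨a⟩
  have h2 := congr_app (S.attach_isPushout n A i).w (S.obj n a)
  have h3 := (S.incl n).lanUnit_app_app_lanAdjunction_counit_app_app Z ⟨a⟩
  dsimp at h1 h2 h3
  rw [attachApp, reassoc_of% h1, ← h2, reassoc_of% h3]

variable {A i}

/-- The universal property of `attach`. -/
def attachDesc {G : D ⥤ M} (h : Z ⟶ G) (p : ∀ a, A a ⟶ G.obj (S.obj n a))
    (w : ∀ a, i a ≫ p a = h.app _) : S.attach n A i ⟶ G :=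
  pushout.desc h ((((S.incl n).lanAdjunction M).homEquiv (Discrete.functor A) G).symm
    (Discrete.natTrans fun a => p a.as)) (by
      rw [← Adjunction.homEquiv_naturality_left_symm, Adjunction.homEquiv_counit]
      refine (((S.incl n).lanAdjunction M).counit.naturality h).symm.trans ?_
      refine congrArg (fun k => (S.incl n).lan.map k ≫ _) ?_
      ext ⟨a⟩
      exact (w a).symm)

lemma attachι_desc {G : D ⥤ M} (h : Z ⟶ G) (p : ∀ a, A a ⟶ G.obj (S.obj n a))
    (w : ∀ a, i a ≫ p a = h.app _) : S.attachι n A i ≫ S.attachDesc n h p w = h :=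
  pushout.inl_desc _ _ _

lemma attachApp_desc {G : D ⥤ M} (h : Z ⟶ G) (p : ∀ a, A a ⟶ G.obj (S.obj n a))
    (w : ∀ a, i a ≫ p a = h.app _) (a : S.cells n) :
    S.attachApp n A i a ≫ (S.attachDesc n h p w).app (S.obj n a) = p a := by
  have h1 : S.attachCell n A i ≫ S.attachDesc n h p w = _ := pushout.inr_desc _ _ _
  have h2 := congr_app (((S.incl n).lanAdjunction M).homEquiv_unit (Discrete.functor A) G
    ((((S.incl n).lanAdjunction M).homEquiv (Discrete.functor A) G).symm
    (Discrete.natTrans fun a => p a.as))) ⟨a⟩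
  rw [Equiv.apply_symm_apply, Functor.lanAdjunction_unit] at h2
  rw [attachApp, Category.assoc, ← NatTrans.comp_app, h1]
  exact h2.symm

variable (A i)

/-- No cell of degree `n` maps to one of smaller degree, so the Kan extensions are colimits over an
empty category there, and the attachment changes nothing. -/
lemma isIso_attachι_app {m : ℕ} (hm : m < n) (b : S.cells m) :
    IsIso ((S.attachι n A i).app (S.obj m b)) := by
  have h := (S.attach_isPushout n A i).map ((evaluation D M).obj (S.obj m b))
  have init (B : Discrete (S.cells n) ⥤ M) : IsInitial ((S.free n B).obj (S.obj m b)) :=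
    have : IsEmpty (CostructuredArrow (S.incl n) (S.obj m b)) :=
      ⟨fun x => absurd (S.le_of_hom (a := x.left.as) (b := b) x.hom) (by lia)⟩
    isColimitEquivIsInitialOfIsEmpty _ _
      ((S.incl n).isPointwiseLeftKanExtensionLeftKanExtensionUnit B (S.obj m b))
  have : IsIso (((evaluation D M).obj (S.obj m b)).map ((S.incl n).lan.map
      (Discrete.natTrans (F := S.incl n ⋙ Z) (G := Discrete.functor A) fun a => i a.as))) :=
    isIso_of_isInitial (init _) (init _) _
  exact h.isIso_inl_of_isIso

lemma llp_attachι (Q : MorphismProperty M) (hi : ∀ a, Q.llp (i a)) :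
    (Q.functorCategory D).llp (S.attachι n A i) := by
  refine MorphismProperty.of_isPushout (P := (Q.functorCategory D).llp)
    (S.attach_isPushout n A i) ?_
  intro X Y p hp
  rw [((S.incl n).lanAdjunction M).hasLiftingProperty_iff]
  refine ⟨fun {f g} sq => ?_⟩
  have this' (a : S.cells n) : CommSq (f.app ⟨a⟩) (i a) (p.app (S.obj n a)) (g.app ⟨a⟩) :=
    ⟨congr_app sq.w ⟨a⟩⟩
  have (a : S.cells n) : HasLiftingProperty (i a) (p.app (S.obj n a)) := hi a _ (hp _)
  exact ⟨⟨{
    l := Discrete.natTrans fun a => (this' a.as).lift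
    fac_left := by ext ⟨a⟩; exact (this' a).fac_left
    fac_right := by ext ⟨a⟩; exact (this' a).fac_right }⟩⟩

end attach

end DirectFiltration

namespace DirectFiltration

lemma functorCategory_of_cells {D : Type w} [Category.{0} D] (S : DirectFiltration D)
    {M : Type u} [Category.{v} M] (Q : MorphismProperty M) [Q.RespectsIso] {F G : D ⥤ M} (p : F ⟶ G)
    (h : ∀ n (a : S.cells n), Q (p.app (S.obj n a))) : Q.functorCategory D p := by
  intro X
  obtain ⟨n, a, ⟨e⟩⟩ := S.exists_iso X
  rw [← Q.cancel_right_of_respectsIso _ (G.map e.hom), ← p.naturality,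
    Q.cancel_left_of_respectsIso]
  exact h n a

variable {D : Type w} [Category.{0} D] (S : DirectFiltration D)
  {M : Type u} [Category.{v} M] [HasColimitsOfSize.{w, w} M]

/-! ### Factorizations built by attaching cells in all degrees. -/

section factorization

variable (P Q : MorphismProperty M) [P.HasFactorization Q] {F G : D ⥤ M} (Ψ : F ⟶ G)

/-- An intermediate step in the factorization of a map of diagrams. -/
structure Stage where
  /-- the intermediate diagram -/
  obj : D ⥤ M
  /-- the map from the source -/
  i : F ⟶ obj
  /-- the map to the target -/
  p : obj ⟶ G
  fac : i ≫ p = Ψ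

variable {Ψ} in
/-- The factorization which is used in order to attach a cell at `a`. -/
def Stage.cellFac (s : Stage Ψ) {n : ℕ} (a : S.cells n) :
    MorphismProperty.MapFactorizationData P Q (s.p.app (S.obj n a)) :=
  MorphismProperty.factorizationData P Q _

variable {Ψ} in
/-- The map which adds to a stage the cells of degree `n`. -/
def Stage.ι (s : Stage Ψ) (n : ℕ) :
    s.obj ⟶ S.attach n (fun a => (s.cellFac S P Q a).Z) (fun a => (s.cellFac S P Q a).i) :=
  S.attachι n _ _

variable {Ψ} in
/-- The stage obtained by attaching cells in degree `n`. -/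
def Stage.next (s : Stage Ψ) (n : ℕ) : Stage Ψ where
  obj := S.attach n (fun a => (s.cellFac S P Q a).Z) (fun a => (s.cellFac S P Q a).i)
  i := s.i ≫ s.ι S P Q n
  p := S.attachDesc n s.p (fun a => (s.cellFac S P Q a).p) (fun a => (s.cellFac S P Q a).fac)
  fac := by rw [Category.assoc, Stage.ι, attachι_desc, s.fac]

variable {Ψ} in
/-- The isomorphism from the object attached at `a`. -/
def Stage.cellApp (s : Stage Ψ) {n : ℕ} (a : S.cells n) :
    (s.cellFac S P Q a).Z ⟶ (s.next S P Q n).obj.obj (S.obj n a) :=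
  S.attachApp n (fun a => (s.cellFac S P Q a).Z) (fun a => (s.cellFac S P Q a).i) a

variable {Ψ} in
lemma Stage.isIso_cellApp (s : Stage Ψ) {n : ℕ} (a : S.cells n) : IsIso (s.cellApp S P Q a) :=
  inferInstanceAs (IsIso (S.attachApp n (fun a => (s.cellFac S P Q a).Z)
    (fun a => (s.cellFac S P Q a).i) a))

variable {Ψ} in
lemma Stage.cellApp_fac (s : Stage Ψ) {n : ℕ} (a : S.cells n) :
    (s.cellFac S P Q a).i ≫ s.cellApp S P Q a = (s.ι S P Q n).app (S.obj n a) :=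
  S.attachApp_fac n (fun a => (s.cellFac S P Q a).Z) (fun a => (s.cellFac S P Q a).i) a

variable {Ψ} in
lemma Stage.cellApp_p (s : Stage Ψ) {n : ℕ} (a : S.cells n) :
    s.cellApp S P Q a ≫ (s.next S P Q n).p.app (S.obj n a) = (s.cellFac S P Q a).p :=
  S.attachApp_desc n s.p (fun a => (s.cellFac S P Q a).p) (fun a => (s.cellFac S P Q a).fac) a

variable {Ψ} in
lemma Stage.ι_app_mem_iff (s : Stage Ψ) {n : ℕ} (a : S.cells n) (R : MorphismProperty M)
    [R.RespectsIso] : R ((s.ι S P Q n).app (S.obj n a)) ↔ R (s.cellFac S P Q a).i := by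
  have := s.isIso_cellApp S P Q a
  have h := R.cancel_right_of_respectsIso (s.cellFac S P Q a).i (s.cellApp S P Q a)
  rwa [s.cellApp_fac S P Q a] at h

variable {Ψ} in
lemma Stage.next_p_app_mem [Q.RespectsIso] (s : Stage Ψ) {n : ℕ} (a : S.cells n) :
    Q ((s.next S P Q n).p.app (S.obj n a)) := by
  have := s.isIso_cellApp S P Q a
  have h := Q.cancel_left_of_respectsIso (s.cellApp S P Q a) ((s.next S P Q n).p.app (S.obj n a))
  rw [s.cellApp_p S P Q a] at h
  exact h.1 (s.cellFac S P Q a).hp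

variable {Ψ} in
lemma Stage.llp_ι {R : MorphismProperty M} (s : Stage Ψ) (n : ℕ)
    (h : ∀ a : S.cells n, R.llp ((s.ι S P Q n).app (S.obj n a))) :
    (R.functorCategory D).llp (s.ι S P Q n) :=
  S.llp_attachι n (fun a => (s.cellFac S P Q a).Z)
    (fun a => (s.cellFac S P Q a).i) R (fun a => (s.ι_app_mem_iff S P Q a R.llp).1 (h a))

/-- The stage obtained by attaching cells in degrees `< n`. -/
def stage (n : ℕ) : Stage Ψ :=
  Nat.rec ⟨F, 𝟙 F, Ψ, Category.id_comp _⟩ (fun n s => s.next S P Q n) n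

/-- The inclusion of a stage into the next one. -/
def stageMap (n : ℕ) : (S.stage P Q Ψ n).obj ⟶ (S.stage P Q Ψ (n + 1)).obj :=
  (S.stage P Q Ψ n).ι S P Q n

lemma stage_i_comp (n : ℕ) :
    (S.stage P Q Ψ n).i ≫ S.stageMap P Q Ψ n = (S.stage P Q Ψ (n + 1)).i := rfl

lemma stageMap_p (n : ℕ) :
    S.stageMap P Q Ψ n ≫ (S.stage P Q Ψ (n + 1)).p = (S.stage P Q Ψ n).p :=
  S.attachι_desc ..

/-- The sequence of all stages. -/
def stages : ℕ ⥤ (D ⥤ M) := Functor.ofSequence (S.stageMap P Q Ψ)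

lemma stages_map_succ (n : ℕ) :
    (S.stages P Q Ψ).map (homOfLE (Nat.le_add_right n 1)) = S.stageMap P Q Ψ n :=
  Functor.ofSequence_map_homOfLE_succ _ _

lemma isIso_stageMap_app {m n : ℕ} (hm : m < n) (b : S.cells m) :
    IsIso ((S.stageMap P Q Ψ n).app (S.obj m b)) :=
  S.isIso_attachι_app n _ _ hm b

lemma isIso_stages_map_app {m n k : ℕ} (f : n ⟶ k) (hm : m < n) (b : S.cells m) :
    IsIso (((S.stages P Q Ψ).map f).app (S.obj m b)) := by
  obtain ⟨k, rfl⟩ := Nat.exists_eq_add_of_le (leOfHom f)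
  induction k with
  | zero =>
    obtain rfl : f = 𝟙 _ := Subsingleton.elim _ _
    rw [CategoryTheory.Functor.map_id]
    infer_instance
  | succ k hk =>
    obtain rfl : f = homOfLE (Nat.le_add_right n k) ≫ homOfLE (Nat.le_add_right (n + k) 1) :=
      Subsingleton.elim _ _
    have h1 := hk (homOfLE (Nat.le_add_right n k))
    have h2 := S.isIso_stageMap_app P Q Ψ (n := n + k) (by lia) b
    rw [Functor.map_comp, NatTrans.comp_app, stages_map_succ]
    exact @IsIso.comp_isIso _ _ _ _ _ _ _ h1 h2

instance : HasColimitsOfShape ℕ M :=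
  have := hasColimitsOfSizeShrink.{0, 0, w, w} M
  inferInstance

/-- The map to the target, on all stages. -/
def stagesDesc : S.stages P Q Ψ ⟶ (Functor.const _).obj G :=
  NatTrans.ofSequence (fun n => (S.stage P Q Ψ n).p) (fun n => by
    rw [stages_map_succ]
    exact (S.stageMap_p P Q Ψ n).trans (Category.comp_id _).symm)

/-- The factorization obtained by attaching cells in all degrees. -/
def total : Stage Ψ where
  obj := colimit (S.stages P Q Ψ)
  i := colimit.ι (S.stages P Q Ψ) 0
  p := colimit.desc (S.stages P Q Ψ) ⟨G, S.stagesDesc P Q Ψ⟩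
  fac := colimit.ι_desc _ _

/-- The inclusion of the `n`-th stage in the final one. -/
def stageι (n : ℕ) : (S.stage P Q Ψ n).obj ⟶ (S.total P Q Ψ).obj :=
  colimit.ι (S.stages P Q Ψ) n

lemma stageMap_stageι (n : ℕ) :
    S.stageMap P Q Ψ n ≫ S.stageι P Q Ψ (n + 1) = S.stageι P Q Ψ n := by
  rw [← stages_map_succ]
  exact colimit.w _ _

lemma stageι_p (n : ℕ) : S.stageι P Q Ψ n ≫ (S.total P Q Ψ).p = (S.stage P Q Ψ n).p :=
  colimit.ι_desc _ _

lemma stage_i_stageι (n : ℕ) :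
    (S.stage P Q Ψ n).i ≫ S.stageι P Q Ψ n = (S.total P Q Ψ).i := by
  induction n with
  | zero => exact Category.id_comp _
  | succ n hn => rw [← hn, ← stage_i_comp, Category.assoc, stageMap_stageι]

/-- At a cell of degree `m` the sequence of stages is constant from `m + 1` on, since later
attachments happen in higher degrees. -/
lemma isIso_stageι_app {m n : ℕ} (hm : m < n) (b : S.cells m) :
    IsIso ((S.stageι P Q Ψ n).app (S.obj m b)) := by
  have h : (S.stages P Q Ψ ⋙ (evaluation D M).obj (S.obj m b)).IsEventuallyConstantFrom n :=
    fun k f => S.isIso_stages_map_app P Q Ψ f hm b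
  exact h.isIso_ι_of_isColimit
    (isColimitOfPreserves ((evaluation D M).obj (S.obj m b)) (colimit.isColimit (S.stages P Q Ψ)))

lemma stageMap_app_mem [P.RespectsIso] (n : ℕ) (a : S.cells n) :
    P ((S.stageMap P Q Ψ n).app (S.obj n a)) :=
  ((S.stage P Q Ψ n).ι_app_mem_iff S P Q a P).2 (MorphismProperty.MapFactorizationData.hi _)

lemma stage_p_app_mem [Q.RespectsIso] (n : ℕ) (a : S.cells n) :
    Q ((S.stage P Q Ψ (n + 1)).p.app (S.obj n a)) :=
  (S.stage P Q Ψ n).next_p_app_mem S P Q a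

lemma total_p_app_mem [Q.RespectsIso] (n : ℕ) (a : S.cells n) :
    Q ((S.total P Q Ψ).p.app (S.obj n a)) := by
  have := S.isIso_stageι_app P Q Ψ (Nat.lt_succ_self n) a
  rw [← Q.cancel_left_of_respectsIso ((S.stageι P Q Ψ (n + 1)).app (S.obj n a)),
    ← NatTrans.comp_app, stageι_p]
  exact S.stage_p_app_mem P Q Ψ n a

lemma total_p_mem [Q.RespectsIso] : Q.functorCategory D (S.total P Q Ψ).p :=
  S.functorCategory_of_cells Q _ (S.total_p_app_mem P Q Ψ)

lemma llp_stageMap {R : MorphismProperty M} (n : ℕ)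
    (h : ∀ a : S.cells n, R.llp ((S.stageMap P Q Ψ n).app (S.obj n a))) :
    (R.functorCategory D).llp (S.stageMap P Q Ψ n) :=
  (S.stage P Q Ψ n).llp_ι S P Q n h

lemma llp_total_i {R : MorphismProperty M}
    (h : ∀ n (a : S.cells n), R.llp ((S.stageMap P Q Ψ n).app (S.obj n a))) :
    (R.functorCategory D).llp (S.total P Q Ψ).i := by
  intro X Y p hp
  refine HasLiftingProperty.transfiniteComposition.hasLiftingProperty_ι_app_bot
    (F := S.stages P Q Ψ) (colimit.isColimit _) (fun n _ => ?_)
  have := S.stages_map_succ P Q Ψ n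
  exact (congrArg (fun k => HasLiftingProperty k p) this).mpr (S.llp_stageMap P Q Ψ n (h n) p hp)

end factorization

end DirectFiltration

/-! ### Bounded diagrams as diagrams on a quotient of the simplex category. -/

section Reduced

variable {K : SSet.{w}}

namespace SimplexCat

/-- The map of `SimplexCategory` underlying a morphism of simplices. -/
abbrev base {X Y : SimplexCat K} (φ : X ⟶ Y) : X.unop.1.unop ⟶ Y.unop.1.unop := φ.unop.1.unop

lemma hom_ext {X Y : SimplexCat K} {φ ψ : X ⟶ Y} (h : base φ = base ψ) : φ = ψ :=
  Quiver.Hom.unop_inj (Subtype.ext (Quiver.Hom.unop_inj h))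

lemma map_base {X Y : SimplexCat K} (φ : X ⟶ Y) : K.map (base φ).op Y.unop.2 = X.unop.2 :=
  φ.unop.2

/-- Constructor for morphisms between simplices. -/
abbrev homOf {X Y : SimplexCat K} (φ : X.unop.1.unop ⟶ Y.unop.1.unop)
    (h : K.map φ.op Y.unop.2 = X.unop.2) : X ⟶ Y :=
  Quiver.Hom.op (X := Y.unop) (Y := X.unop) ⟨φ.op, h⟩

end SimplexCat

open SimplexCat

variable {C : Type u} [Category.{v} C]

lemma isIso_of_isIso_base {X Y : SimplexCat K} (s : X ⟶ Y) [IsIso (base s)] : IsIso s := by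
  have : IsIso ((CategoryOfElements.π K).map s.unop) :=
    inferInstanceAs (IsIso (base s).op)
  have : IsIso s.unop := isIso_of_reflects_iso s.unop (CategoryOfElements.π K)
  exact inferInstanceAs (IsIso s.unop.op)

/-- A surjection is either bijective or factors through some `σ i`, which lowers the dimension of
the source; induction on that dimension. -/
lemma IsBounded.isIso_map {F : SimplexCat K ⥤ C} (hF : IsBounded K C F) {X Y : SimplexCat K}
    (s : X ⟶ Y) (hs : Epi (base s)) : IsIso (F.map s) := by
  obtain ⟨⟨⟨⟨n⟩⟩, x⟩⟩ := X
  obtain ⟨⟨⟨m⟩, y⟩⟩ := Y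
  by_cases h : Function.Injective (base s).toOrderHom
  · rw [← SimplexCategory.mono_iff_injective] at h
    have : IsIso (base s) := isIso_of_mono_of_epi _
    have := isIso_of_isIso_base s
    infer_instance
  induction n with
  | zero => exact (h (Function.injective_of_subsingleton (α := Fin 1) _)).elim
  | succ n hn =>
    obtain ⟨i, θ, hθ⟩ := SimplexCategory.eq_σ_comp_of_not_injective _ h
    have hs' : Epi (SimplexCategory.σ i ≫ θ) := hθ ▸ hs
    have hxy : K.map (SimplexCategory.σ i).op (K.map θ.op y) = x := by
      have := map_base s
      rw [hθ] at this
      simpa using this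
    let t : SimplexCat.mk (K.map θ.op y) ⟶ SimplexCat.mk y := homOf θ rfl
    have hst : s = homMk (SimplexCategory.σ i) (K.map θ.op y) x hxy ≫ t := hom_ext hθ
    have h1 := hF i (K.map θ.op y) x hxy
    have ht : Epi (base t) := epi_of_epi (SimplexCategory.σ i) θ
    have h2 : IsIso (F.map t) := by
      by_cases h : Function.Injective (base t).toOrderHom
      · rw [← SimplexCategory.mono_iff_injective] at h
        have : IsIso (base t) := isIso_of_mono_of_epi _
        have := isIso_of_isIso_base t
        infer_instance
      · exact hn _ t ht h
    rw [hst, F.map_comp]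
    exact @IsIso.comp_isIso _ _ _ _ _ _ _ h1 h2

variable (K) in
/-- Two morphisms of simplices are related if they coincide after composition with a
degeneracy. -/
def degeneracyRel : HomRel (SimplexCat K) := fun _ Y φ ψ =>
  ∃ (Z : SimplexCat K) (s : Y ⟶ Z), Epi (base s) ∧ φ ≫ s = ψ ≫ s

variable (K) in
/-- The category obtained from the simplex category by inverting the degeneracies. -/
abbrev Reduced := CategoryTheory.Quotient (degeneracyRel K)

variable (K) in
/-- The quotient functor. -/
abbrev toReduced : SimplexCat K ⥤ Reduced K := CategoryTheory.Quotient.functor _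

lemma exists_section_of_epi {X Y : SimplexCat K} (s : X ⟶ Y) (hs : Epi (base s)) :
    ∃ i : Y ⟶ X, i ≫ s = 𝟙 Y := by
  have : IsSplitEpi (base s) := isSplitEpi_of_epi _
  refine ⟨homOf (section_ (base s)) ?_, hom_ext (IsSplitEpi.id (base s))⟩
  rw [← map_base s]
  change (K.map _ ≫ K.map _) _ = _
  rw [← Functor.map_comp, ← op_comp, IsSplitEpi.id]
  simp

/-- A section `i` of `s` becomes a two-sided inverse: `s ≫ i` and the identity agree after
composition with `s`. -/
lemma isIso_toReduced_map {X Y : SimplexCat K} (s : X ⟶ Y) (hs : Epi (base s)) :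
    IsIso ((toReduced K).map s) := by
  obtain ⟨i, hi⟩ := exists_section_of_epi s hs
  refine ⟨(toReduced K).map i, ?_, ?_⟩
  · rw [← Functor.map_comp, ← CategoryTheory.Functor.map_id]
    exact CategoryTheory.Quotient.sound _ ⟨Y, s, hs, by simp [hi]⟩
  · rw [← Functor.map_comp, hi, CategoryTheory.Functor.map_id]

lemma IsBounded.map_eq {F : SimplexCat K ⥤ C} (hF : IsBounded K C F) {X Y : SimplexCat K}
    {φ ψ : X ⟶ Y} (h : degeneracyRel K φ ψ) : F.map φ = F.map ψ := by
  obtain ⟨Z, s, hs, h⟩ := h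
  have := hF.isIso_map s hs
  rw [← cancel_mono (F.map s), ← F.map_comp, ← F.map_comp, h]

lemma isBounded_toReduced_comp (G : Reduced K ⥤ C) : IsBounded K C (toReduced K ⋙ G) := by
  intro n i x y h
  have := isIso_toReduced_map (homMk (SimplexCategory.σ i) x y h)
    (inferInstanceAs (Epi (SimplexCategory.σ i)))
  dsimp only [Functor.comp_map]
  infer_instance

variable (K C) in
/-- Diagrams on the reduced simplex category are bounded diagrams. -/
def ofReduced : (Reduced K ⥤ C) ⥤ FunB K C :=
  (IsBounded K C).lift ((Functor.whiskeringLeft _ _ C).obj (toReduced K)) isBounded_toReduced_comp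

variable (K C) in
/-- Bounded diagrams are diagrams on the reduced simplex category. -/
def descReduced : FunB K C ⥤ (Reduced K ⥤ C) where
  obj F := CategoryTheory.Quotient.lift _ F.obj (fun _ _ _ _ h => F.property.map_eq h)
  map {F G} Ψ := CategoryTheory.Quotient.natTransLift _
    { app := fun X => Ψ.hom.app X
      naturality := fun _ _ f => Ψ.hom.naturality f }
  map_id _ := by
    apply CategoryTheory.Quotient.natTrans_ext
    ext X
    rfl
  map_comp _ _ := by
    apply CategoryTheory.Quotient.natTrans_ext
    ext X
    rfl

variable (K C) in
/-- Bounded diagrams are equivalent to diagrams on the reduced simplex category. -/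
def reducedEquivalence : FunB K C ≌ (Reduced K ⥤ C) where
  functor := descReduced K C
  inverse := ofReduced K C
  unitIso := Iso.refl _
  counitIso := NatIso.ofComponents (fun G => CategoryTheory.Quotient.natIsoLift _
    (Iso.refl (toReduced K ⋙ G))) (fun _ => by
    apply CategoryTheory.Quotient.natTrans_ext
    ext X
    exact (Category.comp_id _).trans (Category.id_comp _).symm)
  functor_unitIso_comp F := by
    apply CategoryTheory.Quotient.natTrans_ext
    ext X
    exact Category.id_comp _

lemma mono_base_of_nonDegenerate {n : ℕ} (a : K.nonDegenerate n) {Y : SimplexCat K}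
    (φ : SimplexCat.mk a.1 ⟶ Y) : Mono (base φ) :=
  K.mono_of_nonDegenerate a (base φ) _ (map_base φ)

variable (K) in
/-- The filtration of the reduced simplex category by the dimensions of the nondegenerate
simplices. -/
abbrev dimFiltration : DirectFiltration (Reduced K) where
  cells n := K.nonDegenerate n
  obj n a := (toReduced K).obj (SimplexCat.mk a.1)
  full n := ⟨fun {a b} f => by
    obtain ⟨φ, rfl⟩ := (toReduced K).map_surjective f
    obtain ⟨a⟩ := a
    obtain ⟨b⟩ := b
    have := mono_base_of_nonDegenerate a φ
    have h : base φ = 𝟙 _ := SimplexCategory.eq_id_of_mono (x := ⦋n⦌) (base φ)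
    obtain rfl : a = b := by
      have := map_base φ
      rw [h] at this
      ext1
      simpa using this.symm
    exact ⟨𝟙 _, by
      rw [CategoryTheory.Functor.map_id, hom_ext (φ := φ) (ψ := 𝟙 _) h, CategoryTheory.Functor.map_id]
      rfl⟩⟩
  le_of_hom {m n a b} f := by
    obtain ⟨φ, rfl⟩ := (toReduced K).map_surjective f
    have := mono_base_of_nonDegenerate a φ
    exact SimplexCategory.le_of_mono (n := m) (m := n) (base φ)
  exists_iso := by
    rintro ⟨⟨⟨⟨⟨n⟩⟩, x⟩⟩⟩
    obtain ⟨m, f, hf, y, hy⟩ := K.exists_nonDegenerate x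
    have := isIso_toReduced_map (homMk f y.1 x hy.symm) hf
    exact ⟨m, y, ⟨asIso ((toReduced K).map (homMk f y.1 x hy.symm))⟩⟩

end Reduced

/-! ### Free diagrams and the boundary of a nondegenerate simplex. -/

section Boundary

open SimplexCat

variable {K : SSet.{w}} {n : ℕ} {x : K _⦋n⦌}

/-- The simplex of `∂Δ[n]` corresponding to a morphism of simplices with target `x` which is not
surjective. -/
abbrev boundaryMk {Y : SimplexCat K} (φ : Y ⟶ SimplexCat.mk x) (h : ¬ Epi (base φ)) :
    SimplexCat (SSet.boundary.{w} n : SSet.{w}) :=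
  op ⟨Y.unop.1, ⟨SSet.stdSimplex.objEquiv.symm (base φ),
    fun h' => h (SimplexCategory.epi_iff_surjective.2 h')⟩⟩

lemma map_id_op_apply (Y : SimplexCat K) : K.map (𝟙 Y.unop.1.unop).op Y.unop.2 = Y.unop.2 := by
  simp

/-- The canonical isomorphism from the source of a morphism with target `x` to its image
in `K`. -/
abbrev toBoundary {Y : SimplexCat K} (φ : Y ⟶ SimplexCat.mk x) (h : ¬ Epi (base φ)) :
    Y ⟶ (simplexFunctor x).obj ((boundaryFunctor n).obj (boundaryMk φ h)) :=
  homOf (𝟙 _) (by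
    refine Eq.trans ?_ (map_base φ)
    refine (map_id_op_apply
      ((simplexFunctor x).obj ((boundaryFunctor n).obj (boundaryMk φ h)))).trans ?_
    rfl)

/-- The canonical morphism to `x` from the image in `K` of a simplex of `∂Δ[n]`. -/
abbrev boundaryHom (x : K _⦋n⦌) (t : SimplexCat (SSet.boundary.{w} n : SSet.{w})) :
    (simplexFunctor x).obj ((boundaryFunctor n).obj t) ⟶ SimplexCat.mk x :=
  homMk (SSet.stdSimplex.objEquiv ((boundaryFunctor n).obj t).unop.2) x
    ((SSet.yonedaEquiv.symm x).app _ ((boundaryFunctor n).obj t).unop.2) rfl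

lemma not_epi_boundaryHom (t : SimplexCat (SSet.boundary.{w} n : SSet.{w})) :
    ¬ Epi (base (boundaryHom x t)) := fun h =>
  t.unop.2.2 (SimplexCategory.epi_iff_surjective.1 h)

lemma not_epi_comp_boundaryHom (t : SimplexCat (SSet.boundary.{w} n : SSet.{w}))
    {Y : SimplexCat K} (ψ : Y ⟶ (simplexFunctor x).obj ((boundaryFunctor n).obj t)) :
    ¬ Epi (base (ψ ≫ boundaryHom x t)) := fun h =>
  not_epi_boundaryHom (x := x) t (by
    have : Epi (base ψ ≫ base (boundaryHom x t)) := h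
    exact epi_of_epi (base ψ) (base (boundaryHom x t)))

lemma toBoundary_comp {Y : SimplexCat K} (φ : Y ⟶ SimplexCat.mk x) (h : ¬ Epi (base φ)) :
    toBoundary φ h ≫ boundaryHom x (boundaryMk φ h) = φ :=
  hom_ext (Category.id_comp _)

variable {M : Type u} [Category.{v} M] {G : Reduced K ⥤ M}
  (c : Cocone (boundaryFunctor n ⋙ simplexFunctor x ⋙ toReduced K ⋙ G))

/-- The component of a cocone at a morphism with target `x`. -/
def boundaryVal {Y : SimplexCat K} (φ : Y ⟶ SimplexCat.mk x) (h : ¬ Epi (base φ)) :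
    G.obj ((toReduced K).obj Y) ⟶ c.pt :=
  G.map ((toReduced K).map (toBoundary φ h)) ≫ c.ι.app (boundaryMk φ h)

/-- Any factorization through a boundary simplex computes `boundaryVal`, not only the tautological
one used to define it. -/
lemma boundaryVal_comp (t : SimplexCat (SSet.boundary.{w} n : SSet.{w}))
    {Y : SimplexCat K} (ψ : Y ⟶ (simplexFunctor x).obj ((boundaryFunctor n).obj t)) :
    boundaryVal c (ψ ≫ boundaryHom x t) (not_epi_comp_boundaryHom t ψ) =
      G.map ((toReduced K).map ψ) ≫ c.ι.app t := by
  let β : boundaryMk (ψ ≫ boundaryHom x t) (not_epi_comp_boundaryHom t ψ) ⟶ t :=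
    homOf (X := boundaryMk (ψ ≫ boundaryHom x t) (not_epi_comp_boundaryHom t ψ)) (Y := t)
      (φ := (base ψ :)) (by
      apply Subtype.ext
      apply SSet.stdSimplex.objEquiv.injective
      rfl)
  have h : ψ = toBoundary _ (not_epi_comp_boundaryHom t ψ) ≫
      (simplexFunctor x).map ((boundaryFunctor n).map β) := 
    hom_ext (Category.id_comp (base ψ)).symm
  rw [boundaryVal, ← c.w β]
  conv_rhs => rw [h, Functor.map_comp, Functor.map_comp]
  simp

lemma boundaryVal_congr {Y : SimplexCat K} {φ ψ : Y ⟶ SimplexCat.mk x} (h : φ = ψ)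
    (hφ : ¬ Epi (base φ)) : boundaryVal c φ hφ = boundaryVal c ψ (h ▸ hφ) := by
  subst h; rfl

lemma boundaryVal_precomp {Y Z : SimplexCat K} (ψ : Z ⟶ Y) (φ : Y ⟶ SimplexCat.mk x)
    (hφ : ¬ Epi (base φ)) (h : ¬ Epi (base (ψ ≫ φ))) :
    boundaryVal c (ψ ≫ φ) h = G.map ((toReduced K).map ψ) ≫ boundaryVal c φ hφ := by
  have e : ψ ≫ φ = (ψ ≫ toBoundary φ hφ) ≫ boundaryHom x (boundaryMk φ hφ) := by
    rw [Category.assoc, toBoundary_comp]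
  rw [boundaryVal_congr c e, boundaryVal_comp, boundaryVal, Functor.map_comp, Functor.map_comp,
    Category.assoc]

/-- By the uniqueness part of the Eilenberg–Zilber lemma, any degeneracy out of `Z`, prolonged to a
nondegenerate simplex, coincides with `χ`. -/
lemma eq_of_degeneracyRel_of_epi (hx : x ∈ K.nonDegenerate n) {Y Z : SimplexCat K}
    {φ ψ : Y ⟶ Z} (h : degeneracyRel K φ ψ) (χ : Z ⟶ SimplexCat.mk x) (hχ : Epi (base χ)) :
    φ ≫ χ = ψ ≫ χ := by
  obtain ⟨W, s, hs, h⟩ := h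
  obtain ⟨⟨⟨⟨k⟩⟩, z⟩⟩ := Z
  obtain ⟨⟨⟨⟨l⟩⟩, y⟩⟩ := W
  obtain ⟨m, f, hf, y, rfl⟩ := K.exists_nonDegenerate y
  have hz : z = K.map (base s ≫ f).op y.1 := by
    have := map_base s
    simpa using this.symm
  have hz' : z = K.map (base χ).op x := (map_base χ).symm
  have : Epi (base s ≫ f) := epi_comp _ _
  obtain rfl := K.unique_nonDegenerate_dim z (base χ) ⟨x, hx⟩ hz' (base s ≫ f) y hz
  have e := K.unique_nonDegenerate_map z (base χ) ⟨x, hx⟩ hz' (base s ≫ f) y hz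
  apply hom_ext
  change base φ ≫ base χ = base ψ ≫ base χ
  have h' : base φ ≫ base s = base ψ ≫ base s := congrArg base h
  rw [e, reassoc_of% h']

/-- If the last factor `g` is surjective, the two composites are equal by Eilenberg–Zilber.
Otherwise `g` lands in the boundary, and the values agree because `G` is defined on the quotient. -/
lemma boundaryVal_eq_of_compClosure (hx : x ∈ K.nonDegenerate n) {Y : SimplexCat K}
    {φ ψ : Y ⟶ SimplexCat.mk x} (h : HomRel.CompClosure (degeneracyRel K) φ ψ)
    (hφ : ¬ Epi (base φ)) (hψ : ¬ Epi (base ψ)) : boundaryVal c φ hφ = boundaryVal c ψ hψ := by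
  obtain ⟨Z, W, f, m₁, m₂, g, h⟩ := h
  by_cases hg : Epi (base g)
  · exact boundaryVal_congr c (by rw [eq_of_degeneracyRel_of_epi hx h g hg]) _
  · have h1 (m : Z ⟶ W) : f ≫ m ≫ g = (f ≫ m ≫ toBoundary g hg) ≫ boundaryHom x _ := by
      simp only [Category.assoc, toBoundary_comp]
    rw [boundaryVal_congr c (h1 m₁), boundaryVal_congr c (h1 m₂), boundaryVal_comp,
      boundaryVal_comp]
    simp only [Functor.map_comp]
    rw [CategoryTheory.Quotient.sound _ h]

/-- Equality in the quotient is a chain of elementary relations. The hypothesis `hY` keeps every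
intermediate morphism in the boundary, where `boundaryVal` makes sense. -/
lemma boundaryVal_eq (hx : x ∈ K.nonDegenerate n) {Y : SimplexCat K}
    (hY : ∀ φ : Y ⟶ SimplexCat.mk x, ¬ Epi (base φ))
    {φ ψ : Y ⟶ SimplexCat.mk x} (h : (toReduced K).map φ = (toReduced K).map ψ) :
    boundaryVal c φ (hY φ) = boundaryVal c ψ (hY ψ) := by
  replace h := Quot.eqvGen_exact h
  induction h with
  | rel φ ψ h => exact boundaryVal_eq_of_compClosure c hx h _ _
  | refl φ => rfl
  | symm φ ψ _ h => exact h.symm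
  | trans φ ψ χ _ _ h h' => exact h.trans h'

variable (x) in
/-- The cocone with point `F(x)` on the restriction of `F` to `∂Δ[n]`. -/
abbrev boundaryCocone (F : SimplexCat K ⥤ M) :
    Cocone (boundaryFunctor n ⋙ simplexFunctor x ⋙ F) :=
  (simplexCocone F x).whisker (boundaryFunctor n)

lemma not_epi_of_lt {m : ℕ} (hm : m < n) {a : K _⦋m⦌}
    (φ : SimplexCat.mk a ⟶ SimplexCat.mk x) : ¬ Epi (base φ) := fun _ =>
  absurd (SimplexCategory.le_of_epi (base φ)) (by lia)

section Free

variable {m : ℕ} {F : Reduced K ⥤ M} {A : Discrete ((dimFiltration K).cells m) ⥤ M}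
  {U : A ⟶ (dimFiltration K).incl m ⋙ F}

lemma hom_ext_of_isPointwiseLeftKanExtension
    (hU : (Functor.LeftExtension.mk F U).IsPointwiseLeftKanExtension) (X : SimplexCat K) {T : M}
    {f g : F.obj ((toReduced K).obj X) ⟶ T}
    (h : ∀ (a : K.nonDegenerate m) (φ : SimplexCat.mk a.1 ⟶ X),
      U.app ⟨a⟩ ≫ F.map ((toReduced K).map φ) ≫ f = U.app ⟨a⟩ ≫ F.map ((toReduced K).map φ) ≫ g) :
    f = g :=
  (hU ((toReduced K).obj X)).hom_ext (fun j => by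
    obtain ⟨φ, hφ⟩ := (toReduced K).map_surjective (X := SimplexCat.mk j.left.as.1) (Y := X) j.hom
    have := h j.left.as φ
    rw [hφ] at this
    exact (Category.assoc _ _ _).trans (this.trans (Category.assoc _ _ _).symm))

/-- A diagram which is freely generated in dimensions `< n` is determined at a nondegenerate
simplex of dimension `n` by the boundary of this simplex. -/
def isColimitBoundaryCocone (hU : (Functor.LeftExtension.mk F U).IsPointwiseLeftKanExtension)
    (hx : x ∈ K.nonDegenerate n) (hm : m < n) :
    IsColimit (boundaryCocone x (toReduced K ⋙ F)) := by
  -- Morphisms of the quotient are classes, so representatives are chosen; `boundaryVal_eq` makes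
  -- the choice immaterial.
  let pre (j : CostructuredArrow ((dimFiltration K).incl m)
      ((toReduced K).obj (SimplexCat.mk x))) : SimplexCat.mk j.left.as.1 ⟶ SimplexCat.mk x :=
    (toReduced K).preimage (X := SimplexCat.mk j.left.as.1) j.hom
  have pre_map (j) : (toReduced K).map (pre j) = j.hom := (toReduced K).map_preimage _
  let desc (c : Cocone (boundaryFunctor n ⋙ simplexFunctor x ⋙ toReduced K ⋙ F)) :
      F.obj ((toReduced K).obj (SimplexCat.mk x)) ⟶ c.pt :=
    (hU ((toReduced K).obj (SimplexCat.mk x))).desc ⟨c.pt,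
      { app j := U.app j.left ≫ boundaryVal c (pre j) (not_epi_of_lt hm _)
        naturality j j' f := by
          let κ : SimplexCat.mk j.left.as.1 ⟶ SimplexCat.mk j'.left.as.1 :=
            (toReduced K).preimage (((dimFiltration K).incl m).map f.left)
          have hκ : (toReduced K).map κ = ((dimFiltration K).incl m).map f.left :=
            (toReduced K).map_preimage _
          have e : (toReduced K).map (κ ≫ pre j') = (toReduced K).map (pre j) := by
            rw [Functor.map_comp, pre_map, pre_map, hκ]
            exact CostructuredArrow.w f
          have h1 := boundaryVal_eq c hx (not_epi_of_lt hm) e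
          rw [boundaryVal_precomp c κ (pre j') (not_epi_of_lt hm _), hκ] at h1
          refine ((Category.assoc _ _ _).symm.trans ?_).trans (Category.comp_id _).symm
          refine (congrArg (· ≫ _) (U.naturality f.left)).trans ?_
          exact (Category.assoc _ _ _).trans (congrArg (U.app j.left ≫ ·) h1) }⟩
  have desc_fac (c) (a : K.nonDegenerate m) (φ : SimplexCat.mk a.1 ⟶ SimplexCat.mk x) :
      U.app ⟨a⟩ ≫ F.map ((toReduced K).map φ) ≫ desc c =
        U.app ⟨a⟩ ≫ boundaryVal c φ (not_epi_of_lt hm _) := by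
    let j : CostructuredArrow ((dimFiltration K).incl m)
      ((toReduced K).obj (SimplexCat.mk x)) := CostructuredArrow.mk (Y := ⟨a⟩) ((toReduced K).map φ)
    refine (Category.assoc _ _ _).symm.trans (((hU _).fac _ j).trans ?_)
    exact congrArg (U.app ⟨a⟩ ≫ ·) (boundaryVal_eq c hx (not_epi_of_lt hm) (pre_map j))
  exact
    { desc := desc
      fac c t := by
        refine hom_ext_of_isPointwiseLeftKanExtension hU _ (fun a φ => ?_)
        -- A generator mapping to a boundary simplex `t` maps on to `x`, and its prescribed image is
        -- the component of `c` at `t`.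
        have h := desc_fac c a (φ ≫ boundaryHom x t)
        rw [boundaryVal_comp, Functor.map_comp, Functor.map_comp, Category.assoc] at h
        exact h
      uniq c d hd := by
        refine hom_ext_of_isPointwiseLeftKanExtension hU _ (fun a φ => ?_)
        have h := congrArg (fun ψ => U.app ⟨a⟩ ≫ F.map ((toReduced K).map ψ) ≫ d)
          (toBoundary_comp φ (not_epi_of_lt hm φ))
        dsimp only at h
        rw [desc_fac, boundaryVal, ← hd, ← h, Functor.map_comp, Functor.map_comp]
        exact congrArg (U.app ⟨a⟩ ≫ ·) (Category.assoc _ _ _) }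

end Free

end Boundary

/-! ### Latching maps and their identification with values of maps. -/

section LatchingSquare

variable {K : SSet.{w}} {M : Type u} [Category.{v} M] [HasColimitsOfSize.{w, w} M]
  {F G : SimplexCat K ⥤ M} (Ψ : F ⟶ G) {n : ℕ} (x : K _⦋n⦌)

/-- The identity simplex is terminal in the simplex category of `Δ[n]`. -/
instance isIso_simplexToValue (F : SimplexCat K ⥤ M) : IsIso (simplexToValue F x) := by
  let T : SimplexCat (Δ[n] : SSet.{w}) :=
    SimplexCat.mk (SSet.stdSimplex.objEquiv.symm (𝟙 ⦋n⦌))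
  have hT : IsTerminal T := IsTerminal.ofUniqueHom
    (fun t => SimplexCat.homOf (X := t) (Y := T) (SSet.stdSimplex.objEquiv t.unop.2) (by
      apply SSet.stdSimplex.objEquiv.injective
      exact Category.comp_id (SSet.stdSimplex.objEquiv t.unop.2)))
    (fun t φ => SimplexCat.hom_ext (by
      have := congrArg SSet.stdSimplex.objEquiv (SimplexCat.map_base φ)
      exact (Category.comp_id (SimplexCat.base φ)).symm.trans this))
  have h1 : IsIso (colimit.ι (simplexFunctor x ⋙ F) T) := isIso_ι_of_isTerminal hT _
  let t : (simplexFunctor x).obj T ⟶ SimplexCat.mk x :=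
    SimplexCat.homMk (SSet.stdSimplex.objEquiv T.unop.2) x
        ((SSet.yonedaEquiv.symm x).app _ T.unop.2) rfl
  have : IsIso (SimplexCat.base t) := inferInstanceAs (IsIso (𝟙 ⦋n⦌))
  have := isIso_of_isIso_base t
  exact IsIso.of_isIso_fac_left (h := F.map t) (colimit.ι_desc (simplexCocone F x) T)

/-- The canonical map `colim_{∂Δ[n]} F ⟶ F(x)`. -/
def boundaryToValue (F : SimplexCat K ⥤ M) : boundaryColim F x ⟶ F.obj (SimplexCat.mk x) :=
  boundaryToSimplex F x ≫ simplexToValue F x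

lemma ι_boundaryToValue (F : SimplexCat K ⥤ M) (t) :
    colimit.ι (boundaryFunctor n ⋙ simplexFunctor x ⋙ F) t ≫ boundaryToValue x F =
      (boundaryCocone x F).ι.app t := by
  refine (Category.assoc _ _ _).symm.trans ?_
  refine (congrArg (· ≫ simplexToValue F x)
    (colimit.ι_pre (simplexFunctor x ⋙ F) (boundaryFunctor n) t)).trans ?_
  exact colimit.ι_desc _ _

lemma simplexToValue_naturality :
    simplexColimMap Ψ x ≫ simplexToValue G x = simplexToValue F x ≫ Ψ.app (SimplexCat.mk x) := by
  ext t
  have h1 : colimit.ι (simplexFunctor x ⋙ F) t ≫ simplexColimMap Ψ x =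
    Ψ.app _ ≫ colimit.ι (simplexFunctor x ⋙ G) t := ι_colimMap _ _
  have h2 (F : SimplexCat K ⥤ M) : colimit.ι (simplexFunctor x ⋙ F) t ≫ simplexToValue F x =
    (simplexCocone F x).ι.app t := colimit.ι_desc _ _
  rw [reassoc_of% h1, h2, reassoc_of% (h2 F)]
  exact (Ψ.naturality _).symm

lemma boundaryToValue_naturality :
    boundaryToValue x F ≫ Ψ.app (SimplexCat.mk x) = boundaryColimMap Ψ x ≫ boundaryToValue x G := by
  have h := boundaryToSimplex_naturality Ψ x
  rw [boundaryToValue, boundaryToValue, Category.assoc, ← simplexToValue_naturality,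
    reassoc_of% h]

lemma isIso_boundaryToValue (hF : IsColimit (boundaryCocone x F)) :
    IsIso (boundaryToValue x F) := by
  have : boundaryToValue x F = (colimit.isColimit _).desc (boundaryCocone x F) := by
    ext t
    exact (ι_boundaryToValue x F t).trans (colimit.ι_desc _ _).symm
  rw [this]
  exact ((colimit.isColimit _).coconePointUniqueUpToIso hF).isIso_hom

lemma boundaryColimMap_comp {H : SimplexCat K ⥤ M} (Θ : G ⟶ H) :
    boundaryColimMap (Ψ ≫ Θ) x = boundaryColimMap Ψ x ≫ boundaryColimMap Θ x := by
  ext t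
  simp [boundaryColimMap]

variable [HasPushouts M]

/-- The canonical map from `colim_{Δ[n]} F`. -/
def latchingInl : simplexColim F x ⟶ latchingObj Ψ x := pushout.inl _ _

/-- The canonical map from `colim_{∂Δ[n]} G`. -/
def latchingInr : boundaryColim G x ⟶ latchingObj Ψ x := pushout.inr _ _

lemma latching_isPushout :
    IsPushout (boundaryToSimplex F x) (boundaryColimMap Ψ x) (latchingInl Ψ x)
      (latchingInr Ψ x) :=
  IsPushout.of_hasPushout _ _

lemma latchingInr_latchingMap : latchingInr Ψ x ≫ latchingMap Ψ x = boundaryToValue x G :=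
  (Category.assoc _ _ _).symm.trans (congrArg (· ≫ simplexToValue G x) (pushout.inr_desc _ _ _))

lemma latchingInl_latchingMap :
    latchingInl Ψ x ≫ latchingMap Ψ x = simplexToValue F x ≫ Ψ.app _ :=
  ((Category.assoc _ _ _).symm.trans (congrArg (· ≫ simplexToValue G x)
    (pushout.inl_desc _ _ _))).trans (simplexToValue_naturality Ψ x)

variable {Ψ x}

/-- If `Ψ` factors as `Φ ≫ θ` in such a way that `θ` is an isomorphism on the boundary of `x` and
the value at `x` of the target of `Φ` is determined by its boundary, then the latching map of `Ψ`
identifies with the value of `θ` at `x`. -/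
lemma latchingMap_mem_iff {Z : SimplexCat K ⥤ M} {Φ : F ⟶ Z} {θ : Z ⟶ G} (fac : Φ ≫ θ = Ψ)
    (hΦ : IsPushout (boundaryToValue x F) (boundaryColimMap Φ x) (Φ.app (SimplexCat.mk x))
      (boundaryToValue x Z)) [IsIso (boundaryColimMap θ x)]
    (R : MorphismProperty M) [R.RespectsIso] :
    R (latchingMap Ψ x) ↔ R (θ.app (SimplexCat.mk x)) := by
  have hΨ : boundaryColimMap Φ x ≫ boundaryColimMap θ x = boundaryColimMap Ψ x := by
    rw [← fac, boundaryColimMap_comp]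
  have h : IsPushout (boundaryToSimplex F x) (boundaryColimMap Ψ x)
      (simplexToValue F x ≫ Φ.app (SimplexCat.mk x))
      (inv (boundaryColimMap θ x) ≫ boundaryToValue x Z) :=
    IsPushout.of_iso hΦ (Iso.refl _) (asIso (simplexToValue F x)).symm
      (asIso (boundaryColimMap θ x)) (Iso.refl _) (by simp [boundaryToValue])
      (by simp [hΨ]) (by simp) (by simp)
  let e := h.isoIsPushout _ _ (latching_isPushout Ψ x)
  have he : e.hom ≫ latchingMap Ψ x = θ.app (SimplexCat.mk x) := by
    apply h.hom_ext
    · rw [IsPushout.inl_isoIsPushout_hom_assoc, latchingInl_latchingMap, Category.assoc, ← fac,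
        NatTrans.comp_app]
    · rw [IsPushout.inr_isoIsPushout_hom_assoc, latchingInr_latchingMap, Category.assoc,
        boundaryToValue_naturality, IsIso.inv_hom_id_assoc]
  rw [← he, R.cancel_left_of_respectsIso]

end LatchingSquare

section LatchingRetract

variable {K : SSet.{w}} {M : Type u} [Category.{v} M] [HasColimitsOfSize.{w, w} M]
  {F G G' : SimplexCat K ⥤ M} {n : ℕ} (x : K _⦋n⦌)

lemma boundaryColimMap_id : boundaryColimMap (𝟙 F) x = 𝟙 _ := by
  ext t
  simp [boundaryColimMap]

variable [HasPushouts M]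

/-- The functoriality of the latching object with respect to the target. -/
def latchingObjMap (Ψ : F ⟶ G) (s : G ⟶ G') (Ψ' : F ⟶ G') (h : Ψ ≫ s = Ψ') :
    latchingObj Ψ x ⟶ latchingObj Ψ' x :=
  (latching_isPushout Ψ x).desc (latchingInl Ψ' x) (boundaryColimMap s x ≫ latchingInr Ψ' x) (by
    rw [(latching_isPushout Ψ' x).w, ← h, boundaryColimMap_comp, Category.assoc])

lemma latchingObjMap_latchingMap (Ψ : F ⟶ G) (s : G ⟶ G') (Ψ' : F ⟶ G') (h : Ψ ≫ s = Ψ') :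
    latchingObjMap x Ψ s Ψ' h ≫ latchingMap Ψ' x = latchingMap Ψ x ≫ s.app _ := by
  apply (latching_isPushout Ψ x).hom_ext
  · rw [latchingObjMap, IsPushout.inl_desc_assoc, latchingInl_latchingMap,
      reassoc_of% (latchingInl_latchingMap Ψ x), ← h, NatTrans.comp_app]
  · rw [latchingObjMap, IsPushout.inr_desc_assoc, Category.assoc, latchingInr_latchingMap,
      reassoc_of% (latchingInr_latchingMap Ψ x), boundaryToValue_naturality]

/-- The latching map of a map `Ψ` is a retract of the latching map of `Ψ ≫ s` if `s` is a split
monomorphism. -/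
def retractLatchingMap (Ψ : F ⟶ G) (s : G ⟶ G') (p : G' ⟶ G) (h : s ≫ p = 𝟙 G) (Ψ' : F ⟶ G')
    (h' : Ψ ≫ s = Ψ') (h'' : Ψ' ≫ p = Ψ) :
    RetractArrow (latchingMap Ψ x) (latchingMap Ψ' x) where
  i := Arrow.homMk (latchingObjMap x Ψ s Ψ' h') (s.app _)
    (latchingObjMap_latchingMap ..)
  r := Arrow.homMk (latchingObjMap x Ψ' p Ψ h'') (p.app _)
    (latchingObjMap_latchingMap ..)
  retract := by
    ext
    · change latchingObjMap x Ψ s Ψ' h' ≫ latchingObjMap x Ψ' p Ψ h'' = 𝟙 (latchingObj Ψ x)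
      apply (latching_isPushout Ψ x).hom_ext
      · rw [latchingObjMap, latchingObjMap, IsPushout.inl_desc_assoc, IsPushout.inl_desc,
          Category.comp_id]
      · rw [latchingObjMap, latchingObjMap, IsPushout.inr_desc_assoc, Category.assoc,
          IsPushout.inr_desc, ← Category.assoc, ← boundaryColimMap_comp, h, boundaryColimMap_id,
          Category.id_comp, Category.comp_id]
    · change s.app _ ≫ p.app _ = 𝟙 _
      rw [← NatTrans.comp_app, h, NatTrans.id_app]

end LatchingRetract

/-! ### Stages of the factorization and latching squares. -/

section Stages

variable {K : SSet.{w}} {M : Type u} [Category.{v} M] [HasColimitsOfSize.{w, w} M]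
  {n : ℕ} (x : K _⦋n⦌)

/-- A map of diagrams on the reduced simplex category, seen as a map of diagrams on the simplex
category. -/
abbrev restrict {F G : Reduced K ⥤ M} (Φ : F ⟶ G) : toReduced K ⋙ F ⟶ toReduced K ⋙ G :=
  Functor.whiskerLeft (toReduced K) Φ

/-- The condition that the value at `x` of the target of `Φ` is obtained from the source of `Φ`
and the boundary of `x`. -/
def LatchingSq {F G : Reduced K ⥤ M} (Φ : F ⟶ G) : Prop :=
  IsPushout (boundaryToValue x (toReduced K ⋙ F)) (boundaryColimMap (restrict Φ) x)
    ((restrict Φ).app (SimplexCat.mk x)) (boundaryToValue x (toReduced K ⋙ G))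

variable {x}

lemma LatchingSq.id (F : Reduced K ⥤ M) : LatchingSq x (𝟙 F) := by
  have h : restrict (𝟙 F) = 𝟙 _ := Functor.whiskerLeft_id' _
  rw [LatchingSq, h, boundaryColimMap_id]
  exact IsPushout.of_vert_isIso ⟨by simp⟩

lemma LatchingSq.comp {F G H : Reduced K ⥤ M} {Φ : F ⟶ G} {Θ : G ⟶ H} (h : LatchingSq x Φ)
    (h' : LatchingSq x Θ) : LatchingSq x (Φ ≫ Θ) := by
  have := IsPushout.paste_vert h h'
  rwa [← boundaryColimMap_comp, ← NatTrans.comp_app, ← Functor.whiskerLeft_comp] at this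

lemma LatchingSq.of_isPushout {X Y Z Z' : Reduced K ⥤ M} {u : X ⟶ Z} {v : X ⟶ Y} {i : Z ⟶ Z'}
    {j : Y ⟶ Z'} (h : IsPushout u v i j) (hv : LatchingSq x v) : LatchingSq x i := by
  -- Both this boundary colimit and evaluation at `x` preserve pushouts; pasting and cancelling
  -- squares gives the claim.
  let E : (Reduced K ⥤ M) ⥤ M := (Functor.whiskeringLeft _ _ M).obj (toReduced K) ⋙
    (Functor.whiskeringLeft _ _ M).obj (simplexFunctor x) ⋙
    (Functor.whiskeringLeft _ _ M).obj (boundaryFunctor n) ⋙ colim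
  have h1 : IsPushout (boundaryColimMap (restrict u) x) (boundaryColimMap (restrict v) x)
    (boundaryColimMap (restrict i) x) (boundaryColimMap (restrict j) x) := h.map E
  have h2 : IsPushout ((restrict u).app (SimplexCat.mk x)) ((restrict v).app (SimplexCat.mk x))
    ((restrict i).app (SimplexCat.mk x)) ((restrict j).app (SimplexCat.mk x)) :=
    h.map ((evaluation _ _).obj ((toReduced K).obj (SimplexCat.mk x)))
  have h3 := IsPushout.paste_horiz hv h2
  rw [boundaryToValue_naturality, boundaryToValue_naturality] at h3
  exact IsPushout.of_left h3 (boundaryToValue_naturality (restrict i) x) h1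

/-- Both boundary comparison maps are isomorphisms because all generators have dimension `< n`. -/
lemma latchingSq_free (hx : x ∈ K.nonDegenerate n) {m : ℕ} (hm : m < n)
    {A B : Discrete ((dimFiltration K).cells m) ⥤ M} (f : A ⟶ B) :
    LatchingSq x (((dimFiltration K).incl m).lan.map f) := by
  have (A : Discrete ((dimFiltration K).cells m) ⥤ M) :
      IsIso (boundaryToValue x (toReduced K ⋙ (dimFiltration K).free m A)) :=
    isIso_boundaryToValue x (isColimitBoundaryCocone
      (((dimFiltration K).incl m).isPointwiseLeftKanExtensionLeftKanExtensionUnit A) hx hm)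
  exact IsPushout.of_horiz_isIso ⟨boundaryToValue_naturality (restrict _) x⟩

variable (P Q : MorphismProperty M) [P.HasFactorization Q] {F G : Reduced K ⥤ M} (Ψ : F ⟶ G)

lemma latchingSq_stage_i (hx : x ∈ K.nonDegenerate n) {k : ℕ} (hk : k ≤ n) :
    LatchingSq x ((dimFiltration K).stage P Q Ψ k).i := by
  induction k with
  | zero => exact LatchingSq.id _
  | succ k h =>
    rw [← DirectFiltration.stage_i_comp]
    refine (h (by lia)).comp ?_
    exact LatchingSq.of_isPushout ((dimFiltration K).attach_isPushout k
      (fun a => (((dimFiltration K).stage P Q Ψ k).cellFac (dimFiltration K) P Q a).Z)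
      (fun a => (((dimFiltration K).stage P Q Ψ k).cellFac (dimFiltration K) P Q a).i))
      (latchingSq_free hx (by lia) _)

variable (x) in
-- A section of the reduction to `y`, followed by the map to `x`, is injective; if `m = n` it would
-- be bijective, contradicting that it factors through the boundary.
lemma exists_nonDegenerate_of_boundary (t : SimplexCat (SSet.boundary.{w} n : SSet.{w})) :
    ∃ (m : ℕ) (y : K.nonDegenerate m)
      (e : (simplexFunctor x).obj ((boundaryFunctor n).obj t) ⟶ SimplexCat.mk y.1),
      m < n ∧ Epi (SimplexCat.base e) := by
  obtain ⟨m, f, hf, y, hy⟩ := K.exists_nonDegenerate (n := t.unop.1.unop.len)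
    ((simplexFunctor x).obj ((boundaryFunctor n).obj t)).unop.2
  let e : (simplexFunctor x).obj ((boundaryFunctor n).obj t) ⟶ SimplexCat.mk y.1 :=
    SimplexCat.homOf f hy.symm
  have he : Epi (SimplexCat.base e) := hf
  obtain ⟨i, -⟩ := exists_section_of_epi e he
  have hmono : Mono (SimplexCat.base (i ≫ boundaryHom x t)) := mono_base_of_nonDegenerate y _
  refine ⟨m, y, e, lt_of_le_of_ne
    (SimplexCategory.le_of_mono (SimplexCat.base (i ≫ boundaryHom x t))) ?_, he⟩
  rintro rfl
  refine not_epi_comp_boundaryHom t i ?_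
  have : IsIso (SimplexCat.base (i ≫ boundaryHom x t)) := by
    rw [SimplexCategory.isIso_iff_of_mono]
  infer_instance

lemma isIso_boundaryColimMap {θ : F ⟶ G}
    (hθ : ∀ m < n, ∀ a : (dimFiltration K).cells m, IsIso (θ.app ((dimFiltration K).obj m a))) :
    IsIso (boundaryColimMap (restrict θ) x) := by
  have h (t : SimplexCat (SSet.boundary.{w} n : SSet.{w})) : IsIso ((Functor.whiskerLeft (boundaryFunctor n)
      (Functor.whiskerLeft (simplexFunctor x) (restrict θ))).app t) := by
    obtain ⟨m, y, e, hm, he⟩ := exists_nonDegenerate_of_boundary x t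
    have := isIso_toReduced_map e he
    have := hθ m hm y
    have h := θ.naturality ((toReduced K).map e)
    have : IsIso (F.map ((toReduced K).map e) ≫ θ.app ((toReduced K).obj (SimplexCat.mk y.1))) :=
      inferInstance
    rw [h] at this
    have h' : IsIso (θ.app ((toReduced K).obj
        ((simplexFunctor x).obj ((boundaryFunctor n).obj t)))) :=
      IsIso.of_isIso_comp_right _ (G.map ((toReduced K).map e))
    exact h'
  have := NatIso.isIso_of_isIso_app (Functor.whiskerLeft (boundaryFunctor n)
      (Functor.whiskerLeft (simplexFunctor x) (restrict θ)))
  exact inferInstanceAs (IsIso (colim.map (Functor.whiskerLeft (boundaryFunctor n)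
      (Functor.whiskerLeft (simplexFunctor x) (restrict θ)))))

end Stages

/-! ### Lifting properties detected by latching maps. -/

section Cofibrations

variable {K : SSet.{w}} {M : Type u} [Category.{v} M] [HasColimitsOfSize.{w, w} M]

/-- With this trivial factorization the cellular construction rebuilds the given map itself,
exhibiting its skeletal filtration. -/
instance hasFactorization_top_isomorphisms :
    (⊤ : MorphismProperty M).HasFactorization (MorphismProperty.isomorphisms M) where
  nonempty_mapFactorizationData {_ Y} f :=
    ⟨{ Z := Y, i := f, p := 𝟙 Y, hi := trivial, hp := inferInstanceAs (IsIso (𝟙 Y)) }⟩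

lemma hasFactorization_functorCategory (P Q : MorphismProperty M)
    [P.IsWeakFactorizationSystem Q] :
    (Q.functorCategory (Reduced K)).llp.HasFactorization (Q.functorCategory (Reduced K)) where
  nonempty_mapFactorizationData Ψ :=
    have hP : P.IsStableUnderRetracts := by
      rw [← P.llp_eq_of_wfs Q]
      infer_instance
    have hQ : Q.IsStableUnderRetracts := by
      rw [← P.rlp_eq_of_wfs Q]
      infer_instance
    let S := dimFiltration K
    ⟨{  Z := (S.total P Q Ψ).obj
        i := (S.total P Q Ψ).i
        p := (S.total P Q Ψ).p
        fac := (S.total P Q Ψ).fac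
        hi := S.llp_total_i P Q Ψ (fun n a => by
          rw [P.llp_eq_of_wfs Q]
          exact S.stageMap_app_mem P Q Ψ n a)
        hp := S.total_p_mem P Q Ψ }⟩

variable {F G : Reduced K ⥤ M} (Ψ : F ⟶ G) [HasPushouts M]

/-- In the skeletal filtration, stage `n` agrees with `G` on the boundary of an `n`-cell, so the map
attached there is the latching map up to isomorphism. -/
lemma llp_of_latchingMap (R : MorphismProperty M)
    (hΨ : ∀ (n : ℕ) (x : K _⦋n⦌), x ∈ K.nonDegenerate n → R.llp (latchingMap (restrict Ψ) x)) :
    (R.functorCategory (Reduced K)).llp Ψ := by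
  let S := dimFiltration K
  let P : MorphismProperty M := ⊤
  let Q := MorphismProperty.isomorphisms M
  have hp (X) : IsIso ((S.total P Q Ψ).p.app X) := S.total_p_mem P Q Ψ X
  have : IsIso (S.total P Q Ψ).p := NatIso.isIso_of_isIso_app _
  rw [← (S.total P Q Ψ).fac, 
    (R.functorCategory (Reduced K)).llp.cancel_right_of_respectsIso]
  refine S.llp_total_i P Q Ψ (fun n a => ?_)
  have h1 : IsIso ((S.stage P Q Ψ (n + 1)).p.app (S.obj n a)) := S.stage_p_app_mem P Q Ψ n a
  rw [← R.llp.cancel_right_of_respectsIso _ ((S.stage P Q Ψ (n + 1)).p.app (S.obj n a)),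
    ← NatTrans.comp_app, S.stageMap_p]
  have : IsIso (boundaryColimMap (restrict (S.stage P Q Ψ n).p) a.1) :=
    isIso_boundaryColimMap (fun m hm b => by
      have := S.isIso_stageι_app P Q Ψ hm b
      rw [← S.stageι_p, NatTrans.comp_app]
      infer_instance)
  exact (latchingMap_mem_iff (Ψ := restrict Ψ) (Φ := restrict (S.stage P Q Ψ n).i)
    (θ := restrict (S.stage P Q Ψ n).p)
    (by rw [← Functor.whiskerLeft_comp, (S.stage P Q Ψ n).fac])
    (latchingSq_stage_i P Q Ψ a.2 le_rfl) R.llp).1 (hΨ n a.1 a.2)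

/-- Retract argument: `Ψ` is a retract of the cellular map `total.i` with the same source, whose
latching maps are, up to isomorphism, the chosen maps in `P`. -/
lemma latchingMap_of_llp (P Q : MorphismProperty M) [P.IsWeakFactorizationSystem Q]
    (hΨ : (Q.functorCategory (Reduced K)).llp Ψ) {n : ℕ} (x : K _⦋n⦌)
    (hx : x ∈ K.nonDegenerate n) : P (latchingMap (restrict Ψ) x) := by
  let S := dimFiltration K
  have hP : P.IsStableUnderRetracts := by
    rw [← P.llp_eq_of_wfs Q]
    infer_instance
  have hQ : Q.IsStableUnderRetracts := by
    rw [← P.rlp_eq_of_wfs Q]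
    infer_instance
  have : HasLiftingProperty Ψ (S.total P Q Ψ).p := hΨ _ (S.total_p_mem P Q Ψ)
  have sq : CommSq (S.total P Q Ψ).i Ψ (S.total P Q Ψ).p (𝟙 G) :=
    ⟨by rw [(S.total P Q Ψ).fac, Category.comp_id]⟩
  refine P.of_retract (retractLatchingMap x (restrict Ψ) (restrict sq.lift)
    (restrict (S.total P Q Ψ).p) ?_ (restrict (S.total P Q Ψ).i) ?_ ?_) ?_
  · rw [← Functor.whiskerLeft_comp, sq.fac_right, Functor.whiskerLeft_id']
  · rw [← Functor.whiskerLeft_comp, sq.fac_left]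
  · rw [← Functor.whiskerLeft_comp, (S.total P Q Ψ).fac]
  have : IsIso (boundaryColimMap (restrict (S.stageι P Q Ψ n)) x) :=
    isIso_boundaryColimMap (fun m hm b => S.isIso_stageι_app P Q Ψ hm b)
  refine (latchingMap_mem_iff (Φ := restrict (S.stage P Q Ψ n).i)
    (θ := restrict (S.stageι P Q Ψ n))
    (by rw [← Functor.whiskerLeft_comp, S.stage_i_stageι])
    (latchingSq_stage_i P Q Ψ hx le_rfl) P).2 ?_
  change P ((S.stageι P Q Ψ n).app (S.obj n ⟨x, hx⟩))
  have := S.isIso_stageι_app P Q Ψ (Nat.lt_succ_self n) ⟨x, hx⟩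
  rw [← S.stageMap_stageι, NatTrans.comp_app, P.cancel_right_of_respectsIso]
  exact S.stageMap_app_mem P Q Ψ n ⟨x, hx⟩

end Cofibrations

/-! ### Colimits along a functor as left adjoints. -/

section ColimitAlong

variable {D E : Type w} [Category.{0} D] [Category.{0} E] (g : E ⥤ D)
  (M : Type u) [Category.{v} M]

lemma hasLimitsOfShape_of_small [HasLimitsOfSize.{w, w} M]
    (J : Type w) [Category.{0} J] : HasLimitsOfShape J M :=
  have : LocallySmall.{w} J := ⟨fun _ _ => inferInstance⟩
  hasLimitsOfShape_of_equivalence (equivSmallModel.{w} J).symm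

instance [HasLimitsOfSize.{w, w} M] (X : D) : HasLimitsOfShape (StructuredArrow X g) M :=
  hasLimitsOfShape_of_small M _

/-- The functor which sends a diagram `F` to the colimit of `g ⋙ F`. -/
abbrev colimAlong [HasColimitsOfShape E M] : (D ⥤ M) ⥤ M :=
  (Functor.whiskeringLeft E D M).obj g ⋙ colim

/-- The right adjoint of `colimAlong`. -/
abbrev ranConst [HasLimitsOfSize.{w, w} M] : M ⥤ (D ⥤ M) := Functor.const E ⋙ g.ran

/-- Taking the colimit along `g` is left adjoint to the right Kan extension along `g` of constant
diagrams. -/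
def colimAlongAdjunction [HasColimitsOfShape E M] [HasLimitsOfSize.{w, w} M] :
    colimAlong g M ⊣ ranConst g M :=
  (g.ranAdjunction M).comp colimConstAdj

variable {M}

/-- At `d` the Kan extension is the limit of a constant diagram over the structured arrows, so a
lift can be chosen for each arrow separately. -/
lemma ranConst_map_mem [HasLimitsOfSize.{w, w} M] (P : MorphismProperty M) {X Y : M} (p : X ⟶ Y)
    (hp : P.rlp p) : P.rlp.functorCategory D ((ranConst g M).map p) := by
  intro d A B i hi
  have : HasLiftingProperty i p := hp i hi
  let π (Z : M) (j : StructuredArrow d g) : ((ranConst g M).obj Z).obj d ⟶ Z :=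
    ((ranConst g M).obj Z).map j.hom ≫ (g.ranCounit.app ((Functor.const E).obj Z)).app j.right
  have hlim (Z : M) := g.isPointwiseRightKanExtensionRanCounit ((Functor.const E).obj Z) d
  have hπ (Z : M) {j j' : StructuredArrow d g} (f : j ⟶ j') : π Z j = π Z j' := by
    have := ((Functor.RightExtension.mk _
      (g.ranCounit.app ((Functor.const E).obj Z))).coneAt d).w f
    exact ((Category.comp_id _).symm.trans this)
  have hπp (j : StructuredArrow d g) : ((ranConst g M).map p).app d ≫ π Y j = π X j ≫ p := by
    have h1 := ((ranConst g M).map p).naturality j.hom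
    have h2 := congr_app (g.ranCounit.naturality ((Functor.const E).map p)) j.right
    refine (Category.assoc _ _ _).symm.trans ((congrArg (· ≫ _) h1.symm).trans ?_)
    refine (Category.assoc _ _ _).trans (Eq.trans ?_ (Category.assoc _ _ _).symm)
    exact congrArg (((ranConst g M).obj X).map j.hom ≫ ·) h2
  refine ⟨fun {f h} sq => ?_⟩
  have sq' (j : StructuredArrow d g) : CommSq (f ≫ π X j) i p (h ≫ π Y j) := ⟨by
    rw [Category.assoc, ← hπp, ← Category.assoc, sq.w, Category.assoc]⟩
  -- The chosen lift depends only on the two horizontal maps, which coincide for arrows joined by a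
  -- morphism; this makes the lifts a cone.
  have hsq {a a' : A ⟶ X} {b b' : B ⟶ Y} (s : CommSq a i p b) (s' : CommSq a' i p b')
      (ha : a = a') (hb : b = b') : s.lift = s'.lift := by
    subst ha hb; rfl
  let c : Cone (StructuredArrow.proj d g ⋙ (Functor.const E).obj X) :=
    { pt := B
      π :=
        { app := fun j => (sq' j).lift
          naturality := fun j j' f => by
            refine (Category.id_comp _).trans (Eq.trans ?_ (Category.comp_id _).symm)
            exact hsq _ _ (by rw [hπ X f]) (by rw [hπ Y f]) } }
  refine ⟨⟨{ l := (hlim X).lift c, fac_left := ?_, fac_right := ?_ }⟩⟩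
  · refine (hlim X).hom_ext (fun j => ?_)
    refine (Category.assoc _ _ _).trans ((congrArg (i ≫ ·) ((hlim X).fac c j)).trans ?_)
    exact (sq' j).fac_left
  · refine (hlim Y).hom_ext (fun j => ?_)
    refine (Category.assoc _ _ _).trans ((congrArg ((hlim X).lift c ≫ ·) (hπp j)).trans ?_)
    refine (Category.assoc _ _ _).symm.trans ((congrArg (· ≫ p) ((hlim X).fac c j)).trans ?_)
    exact (sq' j).fac_right

lemma colimAlong_map_mem [HasColimitsOfShape E M] [HasLimitsOfSize.{w, w} M]
    (P Q : MorphismProperty M) [P.IsWeakFactorizationSystem Q] {F G : D ⥤ M} (Ψ : F ⟶ G)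
    (hΨ : (Q.functorCategory D).llp Ψ) : P ((colimAlong g M).map Ψ) := by
  rw [← P.llp_eq_of_wfs Q]
  intro X Y p hp
  rw [(colimAlongAdjunction g M).hasLiftingProperty_iff]
  rw [← P.rlp_eq_of_wfs Q] at hΨ hp
  exact hΨ _ (ranConst_map_mem g P p hp)

end ColimitAlong

/-! ### The model structure on bounded diagrams. -/

section ModelStructure

variable {K : SSet.{w}} {M : Type u} [Category.{v} M]

variable (K) in
/-- The class of maps of bounded diagrams which belong objectwise to a given class. -/
def objectwise (Q : MorphismProperty M) : MorphismProperty (FunB K M) :=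
  fun _ _ Ψ => ∀ σ, Q (Ψ.hom.app σ)

lemma objectwise_iff (Q : MorphismProperty M) {F G : FunB K M} (Ψ : F ⟶ G) :
    objectwise K Q Ψ ↔ Q.functorCategory (Reduced K) ((descReduced K M).map Ψ) :=
  ⟨fun h ⟨σ⟩ => h σ, fun h σ => h ⟨σ⟩⟩

lemma llp_objectwise_iff (Q : MorphismProperty M) {F G : FunB K M} (Ψ : F ⟶ G) :
    (objectwise K Q).llp Ψ ↔
      (Q.functorCategory (Reduced K)).llp ((descReduced K M).map Ψ) := by
  constructor
  · intro h X Y p hp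
    exact ((reducedEquivalence K M).toAdjunction.hasLiftingProperty_iff Ψ p).2
      (h _ (fun σ => hp ((toReduced K).obj σ)))
  · intro h X Y p hp
    exact ((reducedEquivalence K M).toAdjunction.hasLiftingProperty_iff Ψ
      ((descReduced K M).map p)).1 (h _ ((objectwise_iff Q p).1 hp))

lemma objectwise_hasFactorization [HasColimitsOfSize.{w, w} M] (P Q : MorphismProperty M)
    [P.IsWeakFactorizationSystem Q] :
    (objectwise K Q).llp.HasFactorization (objectwise K Q) where
  nonempty_mapFactorizationData {F G} Ψ := by
    have := hasFactorization_functorCategory (K := K) P Q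
    let h := MorphismProperty.factorizationData (Q.functorCategory (Reduced K)).llp
      (Q.functorCategory (Reduced K)) ((descReduced K M).map Ψ)
    let i : F ⟶ (ofReduced K M).obj h.Z := (ofReduced K M).map h.i
    let p : (ofReduced K M).obj h.Z ⟶ G := (ofReduced K M).map h.p
    refine ⟨⟨(ofReduced K M).obj h.Z, i, p, ?_, ?_, ?_⟩⟩
    · have := congrArg (ofReduced K M).map h.fac
      rw [Functor.map_comp] at this
      exact this
    · intro X Y q hq
      have : HasLiftingProperty h.i ((descReduced K M).map q) := h.hi _ ((objectwise_iff Q q).1 hq)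
      exact ((reducedEquivalence K M).symm.toAdjunction.hasLiftingProperty_iff h.i q).2 this
    · exact fun σ => h.hp ((toReduced K).obj σ)

end ModelStructure

section ModelStructure

variable {K : SSet.{w}} {M : Type u} [Category.{v} M]

instance hasLimitsOfShape_funB (J : Type*) [Category* J] [HasLimitsOfShape J M] :
    HasLimitsOfShape J (FunB K M) :=
  Adjunction.hasLimitsOfShape_of_equivalence (reducedEquivalence K M).functor

instance hasColimitsOfShape_funB (J : Type*) [Category* J] [HasColimitsOfShape J M] :
    HasColimitsOfShape J (FunB K M) :=
  Adjunction.hasColimitsOfShape_of_equivalence (reducedEquivalence K M).functor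

instance objectwise_isStableUnderRetracts (Q : MorphismProperty M) [Q.IsStableUnderRetracts] :
    (objectwise K Q).IsStableUnderRetracts where
  of_retract h hg σ :=
    Q.of_retract (h.map ((IsBounded K M).ι ⋙ (evaluation _ M).obj σ)) (hg σ)

lemma llp_objectwise_isWeakFactorizationSystem [HasColimitsOfSize.{w, w} M]
    (P Q : MorphismProperty M) [P.IsWeakFactorizationSystem Q] :
    (objectwise K Q).llp.IsWeakFactorizationSystem (objectwise K Q) :=
  have := objectwise_hasFactorization (K := K) P Q
  have : Q.IsStableUnderRetracts := by
    rw [← P.rlp_eq_of_wfs Q]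
    infer_instance
  .mk' _ _ (fun _ _ hi hp => hi _ hp)

/-- The value at `x` is the colimit over the simplices of `Δ[n]`, and colimits along a functor send
such maps into `P`. -/
lemma app_mem_of_llp_objectwise [HasColimitsOfSize.{w, w} M] [HasLimitsOfSize.{w, w} M]
    (P Q : MorphismProperty M) [P.IsWeakFactorizationSystem Q] {F G : FunB K M} (Ψ : F ⟶ G)
    (hΨ : (objectwise K Q).llp Ψ) : objectwise K P Ψ := by
  rintro ⟨⟨⟨⟨n⟩⟩, x⟩⟩
  have h1 : P (simplexColimMap Ψ.hom x) :=
    colimAlong_map_mem (simplexFunctor x ⋙ toReduced K) P Q _ ((llp_objectwise_iff Q Ψ).1 hΨ)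
  have hP : P.RespectsIso := by
    rw [← P.llp_eq_of_wfs Q]
    infer_instance
  exact (P.arrow_mk_iso_iff (Arrow.isoMk (asIso (simplexToValue F.obj x))
    (asIso (simplexToValue G.obj x)) (simplexToValue_naturality Ψ.hom x).symm)).1 h1

variable [ModelCategory M]

lemma weakEquivalences_funB : weakEquivalences (FunB K M) = objectwise K (weakEquivalences M) := by
  ext F G Ψ
  exact forall_congr' fun σ => weakEquivalence_iff _

lemma fibrations_funB : fibrations (FunB K M) = objectwise K (fibrations M) := by
  ext F G Ψ
  exact forall_congr' fun σ => fibration_iff _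

lemma trivialFibrations_funB :
    trivialFibrations (FunB K M) = objectwise K (trivialFibrations M) := by
  ext F G Ψ
  rw [trivialFibrations, fibrations_funB, weakEquivalences_funB]
  exact ⟨fun h σ => ⟨h.1 σ, h.2 σ⟩, fun h => ⟨fun σ => (h σ).1, fun σ => (h σ).2⟩⟩

instance weakEquivalences_funB_hasTwoOutOfThreeProperty :
    (weakEquivalences (FunB K M)).HasTwoOutOfThreeProperty := by
  rw [weakEquivalences_funB]
  exact {
    comp_mem _ _ hf hg σ := (weakEquivalences M).comp_mem _ _ (hf σ) (hg σ)
    of_postcomp _ _ hg hfg σ := (weakEquivalences M).of_postcomp _ _ (hg σ) (hfg σ)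
    of_precomp _ _ hf hfg σ := (weakEquivalences M).of_precomp _ _ (hf σ) (hfg σ) }

variable [HasColimitsOfSize.{w, w} M]

lemma cofibrations_funB :
    cofibrations (FunB K M) = (objectwise K (trivialFibrations M)).llp := by
  ext F G Ψ
  rw [llp_objectwise_iff]
  constructor
  · intro h
    refine llp_of_latchingMap _ _ (fun n x hx => ?_)
    rw [trivialFibrations_llp]
    exact (cofibration_iff _).1 (h n x hx)
  · intro h n x hx
    exact (cofibration_iff _).2
      (latchingMap_of_llp _ (cofibrations M) (trivialFibrations M) h x hx)

variable [HasLimitsOfSize.{w, w} M]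

lemma trivialCofibrations_funB :
    trivialCofibrations (FunB K M) = (objectwise K (fibrations M)).llp := by
  have hW {F G : FunB K M} (Ψ : F ⟶ G) (hΨ : (objectwise K (fibrations M)).llp Ψ) :
      weakEquivalences (FunB K M) Ψ := by
    rw [weakEquivalences_funB]
    exact fun σ => (app_mem_of_llp_objectwise (trivialCofibrations M) (fibrations M) Ψ hΨ σ).2
  ext F G Ψ
  constructor
  · rintro ⟨h1, h2⟩
    have := objectwise_hasFactorization (K := K) (trivialCofibrations M) (fibrations M)
    let h := MorphismProperty.factorizationData (objectwise K (fibrations M)).llp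
      (objectwise K (fibrations M)) Ψ
    have hp : weakEquivalences _ h.p := by
      rw [← h.fac] at h2
      exact (weakEquivalences _).of_precomp _ _ (hW _ h.hi) h2
    -- By two-out-of-three `h.p` is an objectwise acyclic fibration, so `Ψ` lifts against it and is
    -- a retract of `h.i`.
    have : HasLiftingProperty Ψ h.p := by
      rw [cofibrations_funB] at h1
      rw [weakEquivalences_funB] at hp
      exact h1 _ (fun σ => ⟨h.hp σ, hp σ⟩)
    exact MorphismProperty.of_retract (RetractArrow.ofLeftLiftingProperty h.fac) h.hi
  · intro h
    refine ⟨?_, hW Ψ h⟩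
    rw [cofibrations_funB]
    exact fun _ _ p hp => h p (fun σ => (hp σ).1)

variable (K M) in
/-- The model category structure on bounded diagrams. -/
abbrev modelCategoryFunB : ModelCategory (FunB K M) :=
  have : HasFiniteLimits (FunB K M) := ⟨fun _ _ _ => inferInstance⟩
  have : HasFiniteColimits (FunB K M) := ⟨fun _ _ _ => inferInstance⟩
  have : (cofibrations (FunB K M)).IsWeakFactorizationSystem (trivialFibrations (FunB K M)) := by
    rw [cofibrations_funB, trivialFibrations_funB]
    exact llp_objectwise_isWeakFactorizationSystem (cofibrations M) (trivialFibrations M)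
  have : (trivialCofibrations (FunB K M)).IsWeakFactorizationSystem (fibrations (FunB K M)) := by
    rw [trivialCofibrations_funB, fibrations_funB]
    exact llp_objectwise_isWeakFactorizationSystem (trivialCofibrations M) (fibrations M)
  ModelCategory.mk' _

end ModelStructure

/-! ### Formal properties of Quillen adjunctions. -/

section Quillen

variable {C : Type*} [Category* C] {D : Type*} [Category* D]

/-- Ken Brown's lemma. -/
lemma PreservesCofibrations.homotopyMeaningful [ModelCategory C] [ModelCategory D] {H : C ⥤ D}
    (hH : PreservesCofibrations H) : HomotopyMeaningfulOnCofibrant H := by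
  intro X Y f _ _ _
  have h : CofibrantBrownFactorization f := Classical.arbitrary _
  have h1 : WeakEquivalence (H.map h.i) :=
    (weakEquivalence_iff _).2 (hH.acyclic _ (mem_trivialCofibrations _)).2
  have h2 : WeakEquivalence (H.map h.s) :=
    (weakEquivalence_iff _).2 (hH.acyclic _ (mem_trivialCofibrations _)).2
  have h3 : H.map h.s ≫ H.map h.p = 𝟙 _ := by rw [← H.map_comp, h.s_p, H.map_id]
  have h4 : WeakEquivalence (H.map h.p) := weakEquivalence_of_precomp_of_fac h3
  rw [← h.fac, H.map_comp]
  infer_instance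

lemma PreservesCofibrations.isCofibrant [ModelCategory C] [ModelCategory D] {H : C ⥤ D}
    {R : D ⥤ C} (adj : H ⊣ R) (hH : PreservesCofibrations H) (X : C) (hX : IsCofibrant X) :
    IsCofibrant (H.obj X) := by
  have := adj.leftAdjoint_preservesColimits
  rw [isCofibrant_iff_of_isInitial (H.map (initial.to X)) (initialIsInitial.isInitialObj H)]
  exact (cofibration_iff _).2 (hH.cofibration _ ((cofibration_iff _).1 hX))

lemma PreservesFibrations.preservesCofibrations [ModelCategory C] [ModelCategory D] {H : C ⥤ D}
    {R : D ⥤ C} (adj : H ⊣ R) (hR : PreservesFibrations R) : PreservesCofibrations H where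
  cofibration X Y f hf := by
    rw [← trivialFibrations_llp] at hf ⊢
    exact fun _ _ p hp => (adj.hasLiftingProperty_iff f p).2 (hf _ (hR.acyclic p hp))
  acyclic X Y f hf := by
    rw [← fibrations_llp] at hf ⊢
    exact fun _ _ p hp => (adj.hasLiftingProperty_iff f p).2 (hf _ (hR.fibration p hp))

end Quillen

/-! ### Colimits, pull-backs and left Kan extensions. -/

section Colimits

variable {K L : SSet.{w}} {M : Type u} [Category.{v} M] [ModelCategory M]

lemma preservesFibrations_pullB (f : L ⟶ K) : PreservesFibrations (pullB M f) where
  fibration _ _ _ h σ := h ((SimplexCat.map f).obj σ)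
  acyclic _ _ _ h := ⟨fun σ => h.1 ((SimplexCat.map f).obj σ),
    fun σ => h.2 ((SimplexCat.map f).obj σ)⟩

variable [HasLimitsOfSize.{w, w} M] [HasColimitsOfSize.{w, w} M]

/-- The functor `pullB M f ⋙ colimB L M` is a left adjoint. -/
def pullColimAdjunction (f : L ⟶ K) : pullB M f ⋙ colimB L M ⊣
    ranConst (SimplexCat.map f ⋙ toReduced K) M ⋙ ofReduced K M :=
  (reducedEquivalence K M).toAdjunction.comp
    (colimAlongAdjunction (SimplexCat.map f ⋙ toReduced K) M)

variable (M) in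
lemma preservesCofibrations_pullB_colimB (f : L ⟶ K) :
    PreservesCofibrations (pullB M f ⋙ colimB L M) where
  cofibration F G Ψ hΨ := by
    rw [cofibrations_funB, llp_objectwise_iff] at hΨ
    exact colimAlong_map_mem (SimplexCat.map f ⋙ toReduced K) _ (trivialFibrations M) _ hΨ
  acyclic F G Ψ hΨ := by
    rw [trivialCofibrations_funB, llp_objectwise_iff] at hΨ
    exact colimAlong_map_mem (SimplexCat.map f ⋙ toReduced K) _ (fibrations M) _ hΨ

lemma isCofibrant_pullB_colimB (f : L ⟶ K) (F : FunB K M) (hF : IsCofibrant F) :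
    IsCofibrant ((pullB M f ⋙ colimB L M).obj F) :=
  letI := modelCategoryFunB K M
  (preservesCofibrations_pullB_colimB M f).isCofibrant (pullColimAdjunction f) F hF

variable (K M) in
lemma preservesCofibrations_colimB : PreservesCofibrations (colimB K M) where
  cofibration _ _ Ψ := (preservesCofibrations_pullB_colimB M (𝟙 K)).cofibration Ψ
  acyclic _ _ Ψ := (preservesCofibrations_pullB_colimB M (𝟙 K)).acyclic Ψ

lemma homotopyMeaningful_colimB : HomotopyMeaningfulOnCofibrant (colimB K M) :=
  letI := modelCategoryFunB K M
  (preservesCofibrations_colimB K M).homotopyMeaningful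

lemma isCofibrant_colimB (F : FunB K M) (hF : IsCofibrant F) :
    IsCofibrant ((colimB K M).obj F) :=
  isCofibrant_pullB_colimB (𝟙 K) F hF

variable {f : L ⟶ K} (hf : ∀ F : FunB L M, IsBounded K M ((lan M f).obj F.obj))

/-- The left Kan extension is left adjoint to the pull-back. -/
def lanBAdjunction : lanB M f hf ⊣ pullB M f :=
  ((SimplexCat.map f).lanAdjunction M).restrictFullyFaithful (IsBounded L M).fullyFaithfulι
    (IsBounded K M).fullyFaithfulι (Iso.refl _) (Iso.refl _)

lemma preservesCofibrations_lanB : PreservesCofibrations (lanB M f hf) :=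
  letI := modelCategoryFunB K M
  letI := modelCategoryFunB L M
  (preservesFibrations_pullB f).preservesCofibrations (lanBAdjunction hf)

lemma isQuillenPair_lanB : IsQuillenPair (lanB M f hf) (pullB M f) where
  adjunction := ⟨lanBAdjunction hf⟩
  left := preservesCofibrations_lanB hf
  meaningful :=
    letI := modelCategoryFunB K M
    letI := modelCategoryFunB L M
    (preservesCofibrations_lanB hf).homotopyMeaningful
  right := preservesFibrations_pullB f

lemma isCofibrant_lanB (F : FunB L M) (hF : IsCofibrant F) : IsCofibrant ((lanB M f hf).obj F) :=
  letI := modelCategoryFunB K M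
  letI := modelCategoryFunB L M
  (preservesCofibrations_lanB hf).isCofibrant (lanBAdjunction hf) F hF

end Colimits

/-! ### Changing a monotone map one value at a time. -/

section Interpolation

variable {k m : ℕ}

/-- The monotone map which coincides with `a` on the elements smaller than `t` and with `b` on the
others, where `a ≤ b`. -/
def interpolate (a b : ⦋k⦌ ⟶ ⦋m⦌) (h : ∀ j, a j ≤ b j) (t : ℕ) : ⦋k⦌ ⟶ ⦋m⦌ :=
  SimplexCategory.Hom.mk
    { toFun := fun j => if j.1 < t then a j else b j
      monotone' := fun i j hij => by
        have h1 : a i ≤ a j := a.toOrderHom.monotone hij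
        have h2 : b i ≤ b j := b.toOrderHom.monotone hij
        have h3 : i.1 ≤ j.1 := hij
        dsimp only
        split_ifs with h4 h5 h5
        · exact h1
        · exact h1.trans (h j)
        · omega
        · exact h2 }

lemma interpolate_apply (a b : ⦋k⦌ ⟶ ⦋m⦌) (h : ∀ j, a j ≤ b j) (t : ℕ) (j : Fin (k + 1)) :
    interpolate a b h t j = if j.1 < t then a j else b j := rfl

lemma interpolate_zero (a b : ⦋k⦌ ⟶ ⦋m⦌) (h : ∀ j, a j ≤ b j) : interpolate a b h 0 = b := by
  ext j : 3
  exact (interpolate_apply a b h 0 j).trans (if_neg (by omega))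

lemma interpolate_last (a b : ⦋k⦌ ⟶ ⦋m⦌) (h : ∀ j, a j ≤ b j) : interpolate a b h (k + 1) = a := by
  ext j : 3
  exact (interpolate_apply a b h _ j).trans (if_pos j.2)

lemma interpolate_comp {n : ℕ} (a b : ⦋k⦌ ⟶ ⦋m⦌) (h : ∀ j, a j ≤ b j) (t : ℕ) (s : ⦋m⦌ ⟶ ⦋n⦌)
    (hs : a ≫ s = b ≫ s) : interpolate a b h t ≫ s = b ≫ s := by
  ext j : 3
  have h1 : s (a j) = s (b j) := congrArg (fun (u : ⦋k⦌ ⟶ ⦋n⦌) => u j) hs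
  change s (if j.1 < t then a j else b j) = s (b j)
  split_ifs
  · exact h1
  · rfl

/-- The interpolated map on `⦋k + 1⦌` has values `a 0, …, a t, b t, …, b k`; omitting `a t` leaves
the interpolation at `t`, while omitting `b t` gives the one at `t + 1`. -/
lemma δ_interpolate_castSucc (a b : ⦋k⦌ ⟶ ⦋m⦌) (h : ∀ j, a j ≤ b j) (t : Fin (k + 1)) :
    SimplexCategory.δ t.castSucc ≫ interpolate (SimplexCategory.σ t ≫ a)
      (SimplexCategory.σ t ≫ b) (fun j => h (SimplexCategory.σ t j)) (t + 1) =
    interpolate a b h t := by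
  ext j : 3
  have h1 : SimplexCategory.σ t (SimplexCategory.δ t.castSucc j) = j :=
    congrArg (fun (u : ⦋k⦌ ⟶ ⦋k⦌) => u j) SimplexCategory.δ_comp_σ_self
  change (if (Fin.succAbove t.castSucc j).1 < t.1 + 1
    then a (SimplexCategory.σ t (SimplexCategory.δ t.castSucc j))
    else b (SimplexCategory.σ t (SimplexCategory.δ t.castSucc j))) = if j.1 < t.1 then a j else b j
  rw [h1]
  refine if_congr ?_ rfl rfl
  simp only [Fin.succAbove, Fin.lt_def, Fin.val_castSucc]
  split_ifs <;> simp
  all_goals omega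

lemma δ_interpolate_succ (a b : ⦋k⦌ ⟶ ⦋m⦌) (h : ∀ j, a j ≤ b j) (t : Fin (k + 1)) :
    SimplexCategory.δ t.succ ≫ interpolate (SimplexCategory.σ t ≫ a)
      (SimplexCategory.σ t ≫ b) (fun j => h (SimplexCategory.σ t j)) (t + 1) =
    interpolate a b h (t + 1) := by
  ext j : 3
  have h1 : SimplexCategory.σ t (SimplexCategory.δ t.succ j) = j :=
    congrArg (fun (u : ⦋k⦌ ⟶ ⦋k⦌) => u j) SimplexCategory.δ_comp_σ_succ
  change (if (Fin.succAbove t.succ j).1 < t.1 + 1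
    then a (SimplexCategory.σ t (SimplexCategory.δ t.succ j))
    else b (SimplexCategory.σ t (SimplexCategory.δ t.succ j))) =
      if j.1 < t.1 + 1 then a j else b j
  rw [h1]
  refine if_congr ?_ rfl rfl
  simp only [Fin.succAbove, Fin.lt_def, Fin.val_castSucc, Fin.val_succ]
  split_ifs <;> simp
  all_goals omega

lemma σ_comp_δ_succ_apply_le {n : ℕ} (i : Fin (n + 1)) (j : Fin (n + 2)) :
    (SimplexCategory.σ i ≫ SimplexCategory.δ i.succ) j ≤ j := by
  change i.succ.succAbove (i.predAbove j) ≤ j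
  simp only [Fin.succAbove, Fin.predAbove, Fin.lt_def, Fin.le_def, Fin.val_castSucc]
  split_ifs <;> simp at *
  all_goals omega

end Interpolation

/-! ### Boundedness of left Kan extensions. -/

section KanExtension

variable {K L : SSet.{w}} {f : L ⟶ K} {C : Type u} [Category.{v} C]
  {F : SimplexCat L ⥤ C} {E : SimplexCat K ⥤ C} (α : F ⟶ SimplexCat.map f ⋙ E)

lemma map_op_eq_of_comp_eq {k m n : SimplexCategory} {s : m ⟶ n} {x : K.obj (op n)}
    {y : K.obj (op m)} (hs : K.map s.op x = y) {a b : k ⟶ m} (hab : a ≫ s = b ≫ s) :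
    K.map a.op y = K.map b.op y := by
  have h (c : k ⟶ m) : K.map c.op y = K.map (c ≫ s).op x := by
    rw [← hs, op_comp, Functor.map_comp]
    rfl
  rw [h, h, hab]

/-- The map `F(z) ⟶ E(y)` attached to a map `f(z) ⟶ y` of simplices of `K`. -/
def extensionMap {k m : SimplexCategory} {y : K.obj (op m)} {z : L.obj (op k)} (a : k ⟶ m)
    (ha : K.map a.op y = f.app _ z) : F.obj (SimplexCat.mk z) ⟶ E.obj (SimplexCat.mk y) :=
  α.app (SimplexCat.mk z) ≫ E.map (SimplexCat.homMk a y (f.app _ z) ha)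

lemma extensionMap_comp {k l m : SimplexCategory} {y : K.obj (op m)} {z : L.obj (op k)}
    {z' : L.obj (op l)} (a : k ⟶ m) (ha : K.map a.op y = f.app _ z) (d : l ⟶ k)
    (hd : L.map d.op z = z') (hda : K.map (d ≫ a).op y = f.app _ z') :
    extensionMap α (d ≫ a) hda = F.map (SimplexCat.homMk d z z' hd) ≫ extensionMap α a ha := by
  have h1 : SimplexCat.homMk (d ≫ a) y (f.app _ z') hda =
    (SimplexCat.map f).map (SimplexCat.homMk d z z' hd) ≫
      SimplexCat.homMk a y (f.app _ z) ha := rfl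
  have h2 := α.naturality (SimplexCat.homMk d z z' hd)
  refine (congrArg (α.app (SimplexCat.mk z') ≫ ·)
    ((congrArg E.map h1).trans (E.map_comp _ _))).trans ?_
  refine (Category.assoc _ _ _).symm.trans ?_
  exact (congrArg (· ≫ E.map (SimplexCat.homMk a y (f.app _ z) ha)) h2.symm).trans
    (Category.assoc _ _ _)

/-- Consecutive interpolations are two faces of one map defined on the degenerate simplex `σ_t^* z`.
The two faces share the retraction `σ t`, so the bounded diagram `F` does not distinguish them. -/
lemma IsBounded.extensionMap_eq (hF : IsBounded L C F) {k m n : ℕ} {s : ⦋m⦌ ⟶ ⦋n⦌} {x : K _⦋n⦌} {y : K _⦋m⦌}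
    (hs : K.map s.op x = y) {z : L _⦋k⦌} (a b : ⦋k⦌ ⟶ ⦋m⦌) (h : ∀ j, a j ≤ b j)
    (hab : a ≫ s = b ≫ s) (ha : K.map a.op y = f.app _ z) (hb : K.map b.op y = f.app _ z) :
    extensionMap α a ha = extensionMap α b hb := by
  have hc (t : ℕ) : K.map (interpolate a b h t).op y = f.app _ z :=
    (map_op_eq_of_comp_eq hs (interpolate_comp a b h t s hab)).trans hb
  have hstep (t : Fin (k + 1)) : extensionMap α (interpolate a b h t) (hc _) =
      extensionMap α (interpolate a b h (t + 1)) (hc _) := by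
    let z' := L.map (SimplexCategory.σ t).op z
    let ψ := interpolate (SimplexCategory.σ t ≫ a)
      (SimplexCategory.σ t ≫ b) (fun j => h (SimplexCategory.σ t j)) (t + 1)
    have hψ : K.map ψ.op y = f.app _ z' := by
      have h1 : ψ ≫ s = (SimplexCategory.σ t ≫ b) ≫ s :=
        interpolate_comp _ _ _ _ _ (by rw [Category.assoc, hab, Category.assoc])
      rw [map_op_eq_of_comp_eq hs h1, op_comp, Functor.map_comp]
      exact (congrArg (K.map (SimplexCategory.σ t).op) hb).trans
        (NatTrans.naturality_apply f _ z).symm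
    have hd (d : ⦋k⦌ ⟶ ⦋k + 1⦌) (hd : d ≫ SimplexCategory.σ t = 𝟙 _) : L.map d.op z' = z := by
      change (L.map _ ≫ L.map _) _ = _
      rw [← Functor.map_comp, ← op_comp, hd]
      simp
    have h1 := hd _ (SimplexCategory.δ_comp_σ_self (i := t))
    have h2 := hd _ (SimplexCategory.δ_comp_σ_succ (i := t))
    have h3 : F.map (SimplexCat.homMk (SimplexCategory.δ t.castSucc) z' z h1) =
        F.map (SimplexCat.homMk (SimplexCategory.δ t.succ) z' z h2) :=
      hF.map_eq ⟨SimplexCat.mk z, SimplexCat.homMk (SimplexCategory.σ t) z z' rfl,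
        inferInstanceAs (Epi (SimplexCategory.σ t)), SimplexCat.hom_ext
          ((SimplexCategory.δ_comp_σ_self (i := t)).trans SimplexCategory.δ_comp_σ_succ.symm)⟩
    have h4 := extensionMap_comp α ψ hψ _ h1
    have h5 := extensionMap_comp α ψ hψ _ h2
    simp only [ψ, δ_interpolate_castSucc] at h4
    simp only [ψ, δ_interpolate_succ] at h5
    rw [h4 (hc _), h5 (hc _), h3]
  have hall (t : ℕ) (ht : t ≤ k + 1) : extensionMap α (interpolate a b h t) (hc _) =
      extensionMap α b hb := by
    induction t with
    | zero => simp only [interpolate_zero]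
    | succ t ih => exact (hstep ⟨t, ht⟩).symm.trans (ih (by omega))
  have := hall (k + 1) le_rfl
  simp only [interpolate_last] at this
  exact this

/-- The face `δ i.succ` gives the inverse. One composite is the identity already in the simplex
category; the other is checked on the generators of the colimit `E(y)`. -/
lemma IsBounded.of_isPointwiseLeftKanExtension (hF : IsBounded L C F)
    (hE : (Functor.LeftExtension.mk E α).IsPointwiseLeftKanExtension) : IsBounded K C E := by
  intro n i x y hxy
  have hyx : K.map (SimplexCategory.δ i.succ).op y = x := by
    rw [← hxy]
    change (K.map _ ≫ K.map _) _ = _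
    rw [← Functor.map_comp, ← op_comp, SimplexCategory.δ_comp_σ_succ]
    simp
  let s := SimplexCat.homMk (SimplexCategory.σ i) x y hxy
  let d := SimplexCat.homMk (SimplexCategory.δ i.succ) y x hyx
  have hds : d ≫ s = 𝟙 _ := SimplexCat.hom_ext SimplexCategory.δ_comp_σ_succ
  refine ⟨E.map d, ?_, ?_⟩
  · refine (hE (SimplexCat.mk y)).hom_ext ?_
    rintro ⟨⟨⟨⟨⟨k⟩⟩, z⟩⟩, ⟨⟩, φ⟩
    let a : ⦋k⦌ ⟶ ⦋n + 1⦌ := SimplexCat.base φ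
    let a' : ⦋k⦌ ⟶ ⦋n + 1⦌ := a ≫ SimplexCategory.σ i ≫ SimplexCategory.δ i.succ
    have ha : K.map a.op y = f.app _ z := SimplexCat.map_base φ
    have ha' : K.map a'.op y = f.app _ z := SimplexCat.map_base (φ ≫ s ≫ d)
    -- Collapsing and reincluding moves `i + 1` down to `i`, so `a' ≤ a`, and both have the same
    -- composite with `σ i`.
    have h := hF.extensionMap_eq α hxy a' a (fun j => σ_comp_δ_succ_apply_le i (a j))
      (by simp only [a', Category.assoc, SimplexCategory.δ_comp_σ_succ, Category.comp_id]) ha' ha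
    have h1 : E.map (SimplexCat.homMk a' y (f.app _ z) ha') = E.map φ ≫ E.map s ≫ E.map d := by
      rw [← E.map_comp, ← E.map_comp]
      rfl
    have h2 : extensionMap α a' ha' = extensionMap α a ha ≫ E.map s ≫ E.map d :=
      (congrArg (α.app (SimplexCat.mk z) ≫ ·) h1).trans (Category.assoc _ _ _).symm
    exact h2.symm.trans (h.trans (Category.comp_id _).symm)
  · rw [← E.map_comp]
    exact (congrArg E.map hds).trans (E.map_id _)

lemma isBounded_lan (M : Type u) [Category.{v} M] [HasColimitsOfSize.{w, w} M] (F : FunB L M) :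
    IsBounded K M ((lan M f).obj F.obj) :=
  F.property.of_isPointwiseLeftKanExtension _
    ((SimplexCat.map f).isPointwiseLeftKanExtensionLeftKanExtensionUnit F.obj)

end KanExtension

end BoundedDiagrams

end

theorem mainTheorem2 {M : Type u} [Category.{v} M] [ModelCategory M]
    [HasLimitsOfSize.{w, w} M] [HasColimitsOfSize.{w, w} M] {L K : SSet.{w}} (f : L ⟶ K) :
    -- bounded diagrams form a model category
    ((HasLimitsOfSize.{w, w} (FunB K M) ∧ HasColimitsOfSize.{w, w} (FunB K M)) ∧
      ∃ m : ModelCategory (FunB K M),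
        m.categoryWithWeakEquivalences = boundedWeakEquivalences K M ∧
        m.categoryWithFibrations = boundedFibrations K M ∧
        m.categoryWithCofibrations = boundedCofibrations K M) ∧
    -- the colimit functor over `K`
    (HomotopyMeaningfulOnCofibrant (colimB K M) ∧
      PreservesCofibrations (colimB K M) ∧
      ∀ F : FunB K M, IsCofibrant F → IsCofibrant ((colimB K M).obj F)) ∧
    -- the pull-back along `f` followed by the colimit functor over `L`
    (PreservesCofibrations (pullB M f ⋙ colimB L M) ∧
      ∀ F : FunB K M, IsCofibrant F → IsCofibrant ((pullB M f ⋙ colimB L M).obj F)) ∧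
    -- the left Kan extension along `f`
    (∃ hf : ∀ F : FunB L M, IsBounded K M ((lan M f).obj F.obj),
      HomotopyMeaningfulOnCofibrant (lanB M f hf) ∧
      PreservesCofibrations (lanB M f hf) ∧
      (∀ F : FunB L M, IsCofibrant F → IsCofibrant ((lanB M f hf).obj F)) ∧
      IsQuillenPair (lanB M f hf) (pullB M f)) := by
  exact ⟨⟨⟨⟨fun _ _ => inferInstance⟩, ⟨fun _ _ => inferInstance⟩⟩,
      modelCategoryFunB K M, rfl, rfl, rfl⟩,
    ⟨homotopyMeaningful_colimB, preservesCofibrations_colimB K M, isCofibrant_colimB⟩,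
    ⟨preservesCofibrations_pullB_colimB M f, isCofibrant_pullB_colimB f⟩,
    isBounded_lan M, (isQuillenPair_lanB _).meaningful, preservesCofibrations_lanB _,
    isCofibrant_lanB _, isQuillenPair_lanB _⟩
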